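/- Let $p\ge 0$, and write points of $\mathbf C^{2p}$ as $(z',z'')$ with $z',z''\in\mathbf C^p$. Let $$M\colon\ z_{p+j}=E_j(z',\bar z'):=h_j(z',\bar z')+q_j(\bar z'),\qquad 1\le j\le p,$$ where $h_j(z',w')$ is a bilinear form in $(z',w')$ and $q_j$ is a quadratic form on $\mathbf C^p$. Let $\mathcal M=\{z''=E(z',w'),\ w''=\bar E(w',z')\}\subset\mathbf C^{2p}\times\mathbf C^{2p}$ be the complexification of $M$ (here $\bar E(w',z')=\overline{E(\bar w',\bar z')}$), with holomorphic coordinates $(z',w')$; let $\pi_1\colon\mathcal M\to\mathbf C^{2p}$, $(z,w)\mapsto z$, and $\rho_0(z',w')=(\bar w',\bar z')$. A deck transformation of $\pi_1$ is a germ $F$ at $0$ of a biholomorphic map of $\mathcal M$ with $F(0)=0$ and $\pi_1\circ F=\pi_1$. Assume that $M$ satisfies condition E: (a) $q=(q_1,\dots,q_p)$ vanishes only at $0$; (b) $\pi_1$ has exactly $2^p$ deck transformations; (c) $\sigma=\tau_1\tau_2$ has $2p$ distinct eigenvalues (those of its differential at $0$), where $\tau_1$ is the deck transformation of $\pi_1$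 whose set of fixed points has the smallest dimension, $p$, and $\tau_2=\rho_0\tau_1\rho_0$. For non-negative integers $e_*,h_*,s_*$ with $e_*+h_*+2s_*=p$ and numbers $\gamma_j$ with $$0<\gamma_j<\tfrac12\ (1\le j\le e_*),\qquad \tfrac12<\gamma_j<\infty\ (e_*<j\le e_*+h_*),\qquad \operatorname{Re}\gamma_j>\tfrac12,\ \operatorname{Im}\gamma_j>0\ (e_*+h_*<j\le p-s_*),$$ put $\gamma_{j+s_*}=1-\bar\gamma_j$ for $e_*+h_*<j\le p-s_*$ and $$\boldsymbol\gamma=\begin{pmatrix}\boldsymbol\gamma_{e_*}&0&0&0\\0&\boldsymbol\gamma_{h_*}&0&0\\0&0&0&\boldsymbol\gamma_{s_*}\\0&0&I_{s_*}-\overline{\boldsymbol\gamma}_{s_*}&0\end{pmatrix},$$ with $\boldsymbol\gamma_{e_*}=\operatorname{diag}(\gamma_1,\dots,\gamma_{e_*})$, $\boldsymbol\gamma_{h_*}=\operatorname{diag}(\gamma_{e_*+1},\dots,\gamma_{e_*+h_*})$, $\boldsymbol\gamma_{s_*}=\operatorname{diag}(\gamma_{e_*+h_*+1},\dots,\gamma_{p-s_*})$.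 For $\hat{\mathbf B}\in GL_p(\mathbf C)$ let $$Q_{\hat{\mathbf B},\boldsymbol\gamma}\colon\ z_{p+j}=L_j(z',\bar z')^2,\quad 1\le j\le p,\qquad (L_1,\dots,L_p)^t=\hat{\mathbf B}(z'-2\boldsymbol\gamma\bar z').$$ Sets are called holomorphically equivalent if a germ of a biholomorphic map at $0$, fixing $0$, takes the germ at $0$ of the first to that of the second. Then the following hold. 1. There are $\boldsymbol\gamma$ as above and $\hat{\mathbf B}\in GL_p(\mathbf C)$ such that $M$ is holomorphically equivalent to $Q_{\hat{\mathbf B},\boldsymbol\gamma}$. In fact a polynomial automorphism $(z',z'')\mapsto(\mathbf Az',\mathbf Uz''+P(z'))$ of $\mathbf C^{2p}$, with $\mathbf A,\mathbf U\in GL_p(\mathbf C)$ and $P$ homogeneous quadratic, maps $M$ onto $Q_{\hat{\mathbf B},\boldsymbol\gamma}$; that is, the equivalence is linear up to the removal of the quadratic terms of $L_j^2$ in $z'$ alone. 2. The numbers $e_*,h_*,s_*$ are determined by the holomorphic equivalence class of $M$, and so are $\gamma_1,\dots,\gamma_p$ up to a permutation. 3. For a given $\boldsymbol\gamma$, $\hat{\mathbf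 B}$ is unique exactly up to the following relation: if $\hat{\mathbf B},\hat{\mathbf B}'\in GL_p(\mathbf C)$ and $M$ is holomorphically equivalent to $Q_{\hat{\mathbf B},\boldsymbol\gamma}$, then $M$ is holomorphically equivalent to $Q_{\hat{\mathbf B}',\boldsymbol\gamma}$ if and only if $$\hat{\mathbf B}'=(\operatorname{diag}_\nu\mathbf d)^{-1}\,\hat{\mathbf B}\,\operatorname{diag}\mathbf a$$ for some permutation $\nu$ of $\{1,\dots,p\}$, some $\mathbf d\in(\mathbf C^*)^p$ and some $\mathbf a\in(\mathbf C^*)^p$ with $a_j\in\mathbf R$ for $j\le e_*+h_*$ and $a_{j+s_*}=\bar a_j$ for $e_*+h_*<j\le p-s_*$. Here $\operatorname{diag}_\nu\mathbf d$ is the matrix whose $(j,\nu(j))$ entry is $d_j$ and whose other entries are $0$. -/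

import Mathlib

open Filter Topology

noncomputable section

namespace CRQuadric

/-- `ℂ^p`. A point of `ℂ^{2p}` is a pair `(z', z'')` in `V p × V p`; complex conjugation of
vectors is `star`. -/
abbrev V (p : ℕ) : Type := Fin p → ℂ

section Germs

variable {X : Type*} [NormedAddCommGroup X] [NormedSpace ℂ X]

/-- `f` represents a germ at `0` of a biholomorphic map fixing `0`. -/
def IsBiholGerm (f : X → X) : Prop :=
  f 0 = 0 ∧ AnalyticAt ℂ f 0 ∧
    ∃ g : X → X, g 0 = 0 ∧ AnalyticAt ℂ g 0 ∧
      (∀ᶠ x in 𝓝 (0 : X), g (f x) = x) ∧ (∀ᶠ y in 𝓝 (0 : X), f (g y) = y)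

/-- Near `0` the set `S` is a complex submanifold through `0` of dimension `d`: a germ of
biholomorphism takes it to a linear subspace of dimension `d`. -/
def IsSubmanifoldGerm (S : Set X) (d : ℕ) : Prop :=
  ∃ (φ : X → X) (W : Submodule ℂ X), IsBiholGerm φ ∧ Module.finrank ℂ W = d ∧
    ∀ᶠ x in 𝓝 (0 : X), x ∈ S ↔ φ x ∈ W

/-- Holomorphic equivalence of the germs at `0` of two subsets. -/
def HolEquiv (M N : Set X) : Prop :=
  ∃ f : X → X, IsBiholGerm f ∧ ∀ᶠ x in 𝓝 (0 : X), x ∈ M ↔ f x ∈ N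

end Germs

variable {p : ℕ}

/-- The vector `E(z', w')` with entries `h_j(z', w') + q_j(w')`. A homogeneous quadratic polynomial
in `z', w'` without terms in `z'` alone or in `w'` alone is a bilinear form in `(z', w')`. -/
def quadE (h : Fin p → LinearMap.BilinForm ℂ (V p)) (q : Fin p → QuadraticForm ℂ (V p))
    (z w : V p) : V p :=
  fun j => h j z w + q j w

/-- The real submanifold `M ⊂ ℂ^{2p}` given by `z'' = E(z', conj z')`. -/
def quadM (h : Fin p → LinearMap.BilinForm ℂ (V p)) (q : Fin p → QuadraticForm ℂ (V p)) :
    Set (V p × V p) :=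
  {z | z.2 = quadE h q z.1 (star z.1)}

/-- The complexification of `M` in `ℂ^{2p} × ℂ^{2p}`, the set of `((z', z''), (w', w''))` with
`z'' = E(z', w')` and `w'' = Ē(w', z')`, where `Ē(w', z') = conj (E(conj w', conj z'))`. -/
def complexification (h : Fin p → LinearMap.BilinForm ℂ (V p))
    (q : Fin p → QuadraticForm ℂ (V p)) : Set ((V p × V p) × (V p × V p)) :=
  {x | x.1.2 = quadE h q x.1.1 x.2.1 ∧
    x.2.2 = star (quadE h q (star x.2.1) (star x.1.1))}

/-- The holomorphic coordinates `(z', w')` on the complexification, as a parametrization. -/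
def complexParam (h : Fin p → LinearMap.BilinForm ℂ (V p)) (q : Fin p → QuadraticForm ℂ (V p))
    (x : V p × V p) : (V p × V p) × (V p × V p) :=
  ((x.1, quadE h q x.1 x.2), (x.2, star (quadE h q (star x.2) (star x.1))))

theorem range_complexParam (h : Fin p → LinearMap.BilinForm ℂ (V p))
    (q : Fin p → QuadraticForm ℂ (V p)) :
    Set.range (complexParam h q) = complexification h q := by
  ext ⟨⟨a, b⟩, ⟨c, d⟩⟩
  constructor
  · rintro ⟨x, hx⟩
    simp only [complexParam, Prod.mk.injEq] at hx
    obtain ⟨⟨rfl, rfl⟩, rfl, rfl⟩ := hx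
    exact ⟨rfl, rfl⟩
  · rintro ⟨h1, h2⟩
    exact ⟨(a, c), by simp only at h1 h2; simp [complexParam, h1, h2]⟩

/-- The projection `π₁ : (z, w) ↦ z` on the complexification, in the coordinates `(z', w')`. -/
def proj1 (h : Fin p → LinearMap.BilinForm ℂ (V p)) (q : Fin p → QuadraticForm ℂ (V p))
    (x : V p × V p) : V p × V p :=
  (complexParam h q x).1

/-- `f` represents a deck transformation of `π₁`: a germ at `0` of a biholomorphic map of the
complexification, written in the coordinates `(z', w')`, with `π₁ ∘ f = π₁`. -/
def IsDeck (h : Fin p → LinearMap.BilinForm ℂ (V p)) (q : Fin p → QuadraticForm ℂ (V p))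
    (f : V p × V p → V p × V p) : Prop :=
  IsBiholGerm f ∧ ∀ᶠ x in 𝓝 (0 : V p × V p), proj1 h q (f x) = proj1 h q x

/-- The set of deck transformations of `π₁`, as germs at `0`. -/
def deckGerms (h : Fin p → LinearMap.BilinForm ℂ (V p)) (q : Fin p → QuadraticForm ℂ (V p)) :
    Set (Germ (𝓝 (0 : V p × V p)) (V p × V p)) :=
  (fun f : V p × V p → V p × V p => (f : Germ (𝓝 (0 : V p × V p)) (V p × V p))) ''
    {f | IsDeck h q f}

/-- The anti-holomorphic involution `ρ₀ (z', w') = (conj w', conj z')`. -/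
def rho0 (x : V p × V p) : V p × V p := (star x.2, star x.1)

/-- `σ = τ₁ τ₂` with `τ₂ = ρ₀ τ₁ ρ₀`. -/
def sigma (τ₁ : V p × V p → V p × V p) : V p × V p → V p × V p :=
  τ₁ ∘ (rho0 ∘ τ₁ ∘ rho0)

/-- Condition B: `q` vanishes only at the origin. -/
def CondB (q : Fin p → QuadraticForm ℂ (V p)) : Prop :=
  ∀ w : V p, (∀ j, q j w = 0) → w = 0

/-- Condition D: condition B holds and `π₁` has `2^p` deck transformations. -/
def CondD (h : Fin p → LinearMap.BilinForm ℂ (V p)) (q : Fin p → QuadraticForm ℂ (V p)) : Prop :=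
  CondB q ∧ (deckGerms h q).ncard = 2 ^ p

/-- Condition E: condition D holds and `σ = τ₁ τ₂` has `2p` distinct eigenvalues, where `τ₁` is the
deck transformation of `π₁` whose fixed-point set has the smallest dimension, `p`. The eigenvalues
are those of the differential of `σ` at its fixed point `0`. -/
def CondE (h : Fin p → LinearMap.BilinForm ℂ (V p)) (q : Fin p → QuadraticForm ℂ (V p)) : Prop :=
  CondD h q ∧
    ∃ τ₁ : V p × V p → V p × V p, IsDeck h q τ₁ ∧
      IsSubmanifoldGerm {x | τ₁ x = x} p ∧
      {μ : ℂ | Module.End.HasEigenvalue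
        ((fderiv ℂ (sigma τ₁) 0 : (V p × V p) →L[ℂ] (V p × V p)) :
          Module.End ℂ (V p × V p)) μ}.ncard = 2 * p

/-- Bishop invariants with `e` elliptic, `h` hyperbolic and `s` complex components,
`e + h + 2 s = p`. With indices counted from `0`, those `j < e` are elliptic, those
`e ≤ j < e + h` hyperbolic, those `e + h ≤ j < e + h + s` complex, and the last `s` entries are
`γ_{j+s} = 1 - conj γ_j` for `j` complex. -/
structure BishopData (p : ℕ) where
  e : ℕ
  h : ℕ
  s : ℕ
  card_eq : e + h + 2 * s = p
  γ : Fin p → ℂ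
  elliptic : ∀ j : Fin p, j.val < e → ∃ x : ℝ, γ j = x ∧ 0 < x ∧ x < 1 / 2
  hyperbolic : ∀ j : Fin p, e ≤ j.val → j.val < e + h → ∃ x : ℝ, γ j = x ∧ 1 / 2 < x
  cplx : ∀ j : Fin p, e + h ≤ j.val → j.val < e + h + s → 1 / 2 < (γ j).re ∧ 0 < (γ j).im
  cplx' : ∀ j k : Fin p, e + h ≤ j.val → j.val < e + h + s → k.val = j.val + s →
    γ k = 1 - star (γ j)

/-- The index `j` itself for `j` elliptic or hyperbolic; the two halves of the complex indices are
exchanged, `j ↔ j + s`. -/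
def BishopData.partner (D : BishopData p) (j : Fin p) : Fin p :=
  if j.val < D.e + D.h then j
  else if h2 : j.val < D.e + D.h + D.s then
    ⟨j.val + D.s, by have := D.card_eq; omega⟩
  else ⟨j.val - D.s, by have := j.isLt; omega⟩

/-- The block matrix `γ` with diagonal blocks `γ_e`, `γ_h` and
`(0, γ_s; I - conj γ_s, 0)`: the only non-zero entry of row `j` is `γ_j`, in column `partner j`. -/
def BishopData.mat (D : BishopData p) : Matrix (Fin p) (Fin p) ℂ :=
  Matrix.of fun j k => if k = D.partner j then D.γ j else 0

/-- The quadric `Q_{B,γ} : z_{p+j} = L_j(z', conj z')²`, where `L = B (z' - 2 γ conj z')`. -/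
def BishopData.quadric (D : BishopData p) (B : Matrix (Fin p) (Fin p) ℂ) : Set (V p × V p) :=
  {z | ∀ j, z.2 j = (B.mulVec (z.1 - (2 : ℂ) • D.mat.mulVec (star z.1)) j) ^ 2}

/-- `diag_ν d`, the matrix with entry `d_j` in position `(j, ν j)` and zeros elsewhere. -/
def diagPerm (ν : Equiv.Perm (Fin p)) (d : Fin p → ℂ) : Matrix (Fin p) (Fin p) ℂ :=
  Matrix.of fun j k => if k = ν j then d j else 0

/-- `B' = (diag_ν d)⁻¹ B (diag a)` with `d` and `a` free of zeros, `a_e`, `a_h` real and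
`a_{s+s_*} = conj a_s`. -/
def BishopData.Rel (D : BishopData p) (B B' : Matrix (Fin p) (Fin p) ℂ) : Prop :=
  ∃ (ν : Equiv.Perm (Fin p)) (d a : Fin p → ℂ),
    (∀ j, d j ≠ 0) ∧ (∀ j, a j ≠ 0) ∧ (∀ j, a (D.partner j) = star (a j)) ∧
    B' = (diagPerm ν d)⁻¹ * B * Matrix.diagonal a

/-- Equivalence of two subsets of `ℂ^{2p}` under a polynomial automorphism
`(z', z'') ↦ (A z', U z'' + P(z'))` with `A`, `U` linear and `P` homogeneous quadratic. -/
def QuadraticEquiv (M N : Set (V p × V p)) : Prop :=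
  ∃ (A U : Matrix (Fin p) (Fin p) ℂ) (P : Fin p → QuadraticForm ℂ (V p)),
    IsUnit A ∧ IsUnit U ∧
    ∀ z : V p × V p, z ∈ M ↔ (A.mulVec z.1, U.mulVec z.2 + fun j => P j z.1) ∈ N

end CRQuadric

end

/-! Existence. In the coordinates `(z', w')` the map `π₁` is homogeneous, of degree one in its first
component and two in its second, so the differential at `0` of a deck germ is again a deck
transformation (`IsDeck.fderiv_mem`). As there are finitely many deck germs, one tangent to the
identity has finite order, hence is trivial. So the deck germs are `2^p` linear maps, and all are
involutions. On the fibre `z' = 0` they commute, and by counting they realise every change of signs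
in some basis; invariance of `q` then gives `q(w) = C (S w)²`, with entrywise squares. The smallness
of the fixed-point set forces `τ₁(z', w') = (z', a z' - w')`, and invariance under `τ₁` completes
the square: up to terms in `z'` alone, `M` is `z'' = C (S (z̄' - a z' / 2))²`
(`exists_normalization`).

If `μ` is an eigenvalue of `σ`, then `μ + 2 + μ⁻¹` is one of `ā a`. Having `2p` values of `μ` forces
`p` distinct eigenvalues of `ā a` and excludes the branch values `0` and `4` (`eigSet_of_sigma`).
With `b = a⁻¹`, a linear change of `z'` acts by `b ↦ A⁻¹ b Ā`. The antilinear map `v ↦ b v̄` carries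
the eigenline of `b b̄` for `l` to that for `l̄`; rescaling eigenvectors turns `b` into the block
matrix `γ` (`exists_bishopData_of_eigSet`).

Uniqueness. The two-jet of an equivalence between quadrics already gives an identity `G'(A v) = U
G(v) + P(v)` (`exists_quadratic_of_holEquiv_graph`). Its `v̄ v̄` part says that a linear change of
variables maps squares to combinations of squares, so it is a permutation times a diagonal matrix;
with the `v v̄` part this gives `B' A = diag_ν(d) B` and `γ' Ā = A γ`. The latter makes `A`
intertwine `γ γ̄` and `γ' γ̄'`, whose diagonal entries determine the invariants; when `γ' = γ`,
these entries being distinct, `A` is diagonal. -/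

noncomputable section

/-! ### Germs, second-order jets and equivalences of quadratic graphs. -/

namespace CRQuadric

section Germs

variable {X : Type*} [NormedAddCommGroup X] [NormedSpace ℂ X]

theorem IsBiholGerm.tendsto {f : X → X} (hf : IsBiholGerm f) : Tendsto f (𝓝 0) (𝓝 0) := by
  have := hf.2.1.continuousAt.tendsto
  rwa [hf.1] at this

theorem IsBiholGerm.comp {f g : X → X} (hf : IsBiholGerm f) (hg : IsBiholGerm g) :
    IsBiholGerm (f ∘ g) := by
  obtain ⟨f', hf0, hfa, h1, h2⟩ := hf.2.2
  obtain ⟨g', hg0, hga, h3, h4⟩ := hg.2.2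
  have tf' : Tendsto f' (𝓝 0) (𝓝 0) := by simpa [hf0] using hfa.continuousAt.tendsto
  refine ⟨by simp [hg.1, hf.1], ?_, g' ∘ f', by simp [hg0, hf0], ?_, ?_, ?_⟩
  · exact AnalyticAt.comp (by rw [hg.1]; exact hf.2.1) hg.2.1
  · exact AnalyticAt.comp (by rw [hf0]; exact hga) hfa
  · filter_upwards [hg.tendsto.eventually h1, h3] with x hx hx'
    simp [hx, hx']
  · filter_upwards [tf'.eventually h4, h2] with x hx hx'
    simp [hx, hx']

theorem IsBiholGerm.exists_inverse {f : X → X} (hf : IsBiholGerm f) :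
    ∃ g, IsBiholGerm g ∧ (∀ᶠ x in 𝓝 (0 : X), g (f x) = x) ∧ ∀ᶠ y in 𝓝 (0 : X), f (g y) = y := by
  obtain ⟨g, hg0, hga, h1, h2⟩ := hf.2.2
  exact ⟨g, ⟨hg0, hga, f, hf.1, hf.2.1, h2, h1⟩, h1, h2⟩

theorem isBiholGerm_id : IsBiholGerm (id : X → X) :=
  ⟨rfl, analyticAt_id, id, rfl, analyticAt_id, by simp, by simp⟩

theorem HolEquiv.symm {M N : Set X} (h : HolEquiv M N) : HolEquiv N M := by
  obtain ⟨f, hf, hMN⟩ := h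
  obtain ⟨g, hg, -, h2⟩ := hf.exists_inverse
  refine ⟨g, hg, ?_⟩
  filter_upwards [hg.tendsto.eventually hMN, h2] with x hx hx'
  rw [hx, hx']

theorem HolEquiv.trans {M N S : Set X} (h : HolEquiv M N) (h' : HolEquiv N S) :
    HolEquiv M S := by
  obtain ⟨f, hf, hMN⟩ := h
  obtain ⟨g, hg, hNS⟩ := h'
  refine ⟨g ∘ f, hg.comp hf, ?_⟩
  filter_upwards [hf.tendsto.eventually hNS, hMN] with x hx hx'
  rw [hx', hx]; rfl

theorem fderiv_comp_eq_id {f g : X → X} (hf : AnalyticAt ℂ f 0) (hg : AnalyticAt ℂ g 0)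
    (hf0 : f 0 = 0) (h : ∀ᶠ x in 𝓝 (0 : X), g (f x) = x) :
    (fderiv ℂ g 0).comp (fderiv ℂ f 0) = ContinuousLinearMap.id ℂ X := by
  have h1 : HasFDerivAt (g ∘ f) ((fderiv ℂ g 0).comp (fderiv ℂ f 0)) 0 := by
    refine HasFDerivAt.comp 0 ?_ hf.differentiableAt.hasFDerivAt
    rw [hf0]
    exact hg.differentiableAt.hasFDerivAt
  have h2 : HasFDerivAt (g ∘ f) (ContinuousLinearMap.id ℂ X) 0 :=
    (hasFDerivAt_id (𝕜 := ℂ) (0 : X)).congr_of_eventuallyEq h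
  exact h1.unique h2

theorem IsBiholGerm.bijective_fderiv {f : X → X} (hf : IsBiholGerm f) :
    Function.Bijective (fderiv ℂ f 0) := by
  obtain ⟨g, hg, h1, h2⟩ := hf.exists_inverse
  have e1 := fderiv_comp_eq_id hf.2.1 hg.2.1 hf.1 h1
  have e2 := fderiv_comp_eq_id hg.2.1 hf.2.1 hg.1 h2
  refine ⟨fun x y hxy => ?_, fun y => ⟨fderiv ℂ g 0 y, ?_⟩⟩
  · have := congrArg (fderiv ℂ g 0) hxy
    have ex := DFunLike.congr_fun e1 x
    have ey := DFunLike.congr_fun e1 y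
    simp only [ContinuousLinearMap.comp_apply, ContinuousLinearMap.id_apply] at ex ey
    rw [← ex, ← ey, this]
  · exact DFunLike.congr_fun e2 y

/-- The expansion to second order of an analytic map along the curves `t u + t² w`. -/
theorem exists_tendsto_second_order {Y : Type*} [NormedAddCommGroup Y] [NormedSpace ℂ Y]
    {f : X → Y} (hf : AnalyticAt ℂ f 0) (h0 : f 0 = 0) :
    ∃ B : X →ₗ[ℂ] X →ₗ[ℂ] Y, ∀ u w : X,
      Tendsto (fun t : ℂ => (t ^ 2)⁻¹ • (f (t • u + t ^ 2 • w) - t • fderiv ℂ f 0 u))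
        (𝓝[≠] 0) (𝓝 (fderiv ℂ f 0 w + B u u)) := by
  obtain ⟨ps, hps⟩ := hf
  have hd : ∀ y, ps 1 (fun _ => y) = fderiv ℂ f 0 y := by
    intro y
    rw [hps.fderiv_eq, continuousMultilinearCurryFin1_apply]
    congr 1
  have u0 : ∀ x y z : X, Function.update ![x, y] 0 z = ![z, y] := by
    intro x y z; ext i; fin_cases i <;> rfl
  have u1 : ∀ x y z : X, Function.update ![x, y] 1 z = ![x, z] := by
    intro x y z; ext i; fin_cases i <;> rfl
  let B : X →ₗ[ℂ] X →ₗ[ℂ] Y := LinearMap.mk₂ ℂ (fun x y => ps 2 ![x, y])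
    (fun a b c => by simpa only [u0] using (ps 2).map_update_add ![a, c] 0 a b)
    (fun r a c => by simpa only [u0] using (ps 2).map_update_smul ![a, c] 0 r a)
    (fun a b c => by simpa only [u1] using (ps 2).map_update_add ![a, b] 1 b c)
    (fun r a c => by simpa only [u1] using (ps 2).map_update_smul ![a, c] 1 r c)
  have hB : ∀ y, ps 2 (fun _ => y) = B y y := by
    intro y
    simp only [B, LinearMap.mk₂_apply]
    congr 1
    ext i
    fin_cases i <;> rfl
  refine ⟨B, fun u w => ?_⟩
  have hO := hps.isBigO_sub_partialSum_pow 3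
  simp only [zero_add] at hO
  have hy : Tendsto (fun t : ℂ => t • u + t ^ 2 • w) (𝓝[≠] 0) (𝓝 0) := by
    have : Continuous (fun t : ℂ => t • u + t ^ 2 • w) := by fun_prop
    simpa using (this.tendsto 0).mono_left nhdsWithin_le_nhds
  have hO' := hO.comp_tendsto hy
  have hyO : (fun t : ℂ => ‖t • u + t ^ 2 • w‖ ^ 3) =O[𝓝[≠] 0] fun t : ℂ => t ^ 3 := by
    refine Asymptotics.IsBigO.pow (Asymptotics.IsBigO.norm_left ?_) 3
    have h1 : (fun t : ℂ => u + t • w) =O[𝓝[≠] 0] fun _ => (1 : ℂ) := by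
      have : Continuous (fun t : ℂ => u + t • w) := by fun_prop
      exact ((this.tendsto 0).mono_left nhdsWithin_le_nhds).isBigO_one ℂ
    have h2 := (Asymptotics.isBigO_refl (fun t : ℂ => t) (𝓝[≠] 0)).smul h1
    refine h2.congr (fun t => ?_) (fun t => by simp)
    rw [smul_add, smul_smul, pow_two]
  have hR : Tendsto (fun t : ℂ => (t ^ 2)⁻¹ • (f (t • u + t ^ 2 • w) -
      ps.partialSum 3 (t • u + t ^ 2 • w))) (𝓝[≠] 0) (𝓝 0) := by
    have h1 := (Asymptotics.isBigO_refl (fun t : ℂ => (t ^ 2)⁻¹) (𝓝[≠] 0)).smul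
      (hO'.trans hyO)
    refine h1.trans_tendsto ?_
    refine Tendsto.congr' (f₁ := fun t : ℂ => t) ?_
      (tendsto_id.mono_left nhdsWithin_le_nhds)
    filter_upwards [self_mem_nhdsWithin] with t ht
    have : t ≠ 0 := ht
    simp only [smul_eq_mul]
    field_simp
  -- By homogeneity the quadratic term at `t u + t² w`, divided by `t²`, is its value at `u + t w`.
  have hc : Tendsto (fun t : ℂ => fderiv ℂ f 0 w + ps 2 (fun _ => u + t • w)) (𝓝[≠] 0)
      (𝓝 (fderiv ℂ f 0 w + B u u)) := by
    have : Continuous (fun t : ℂ => fderiv ℂ f 0 w + ps 2 (fun _ => u + t • w)) := by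
      have := (ps 2).cont
      fun_prop
    simpa [hB] using (this.tendsto 0).mono_left nhdsWithin_le_nhds
  have := hR.add hc
  rw [zero_add] at this
  refine this.congr' ?_
  filter_upwards [self_mem_nhdsWithin] with t ht
  have ht : t ≠ 0 := ht
  have hp0 : ps 0 (fun _ => t • u + t ^ 2 • w) = 0 := by
    rw [← h0]; exact hps.coeff_zero _
  have e : u + t • w = t⁻¹ • (t • u + t ^ 2 • w) := by
    rw [smul_add, smul_smul, smul_smul, inv_mul_cancel₀ ht, one_smul]
    congr 2
    field_simp
  rw [e, hB, FormalMultilinearSeries.partialSum, Finset.sum_range_succ, Finset.sum_range_succ,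
    Finset.sum_range_one, hp0, hd, hB]
  simp only [map_add, map_smul, smul_sub, smul_add, zero_add, LinearMap.smul_apply,
    LinearMap.add_apply, smul_smul]
  have e1 : (t ^ 2)⁻¹ * t ^ 2 = 1 := by field_simp
  have e2 : t⁻¹ * t⁻¹ = (t ^ 2)⁻¹ := by field_simp
  rw [e1, one_smul]
  simp only [← mul_assoc, e1]
  match_scalars <;> field_simp <;> ring

end Germs

variable {p : ℕ}

theorem tendsto_ofReal_punctured :
    Tendsto (fun t : ℝ => (t : ℂ)) (𝓝[≠] 0) (𝓝[≠] 0) := by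
  refine tendsto_nhdsWithin_iff.2 ⟨?_, ?_⟩
  · simpa using (Complex.continuous_ofReal.tendsto 0).mono_left nhdsWithin_le_nhds
  · filter_upwards [self_mem_nhdsWithin] with t ht
    simpa using ht

/-- Follow the image of the curve `(t v, t² G v)`, which lies in the first graph, and compare terms
of order `t` and `t²`. Only real `t` is allowed, because in the application `G` involves `v̄`. -/
theorem exists_quadratic_of_holEquiv_graph {G G' : V p → V p}
    (hG : ∀ (t : ℝ) v, G ((t : ℂ) • v) = (t : ℂ) ^ 2 • G v)
    (hG' : ∀ (t : ℝ) v, G' ((t : ℂ) • v) = (t : ℂ) ^ 2 • G' v) (hc : Continuous G')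
    (h : HolEquiv {z : V p × V p | z.2 = G z.1} {z : V p × V p | z.2 = G' z.1}) :
    ∃ (A U : Matrix (Fin p) (Fin p) ℂ) (P : Fin p → QuadraticForm ℂ (V p)),
      IsUnit A ∧ IsUnit U ∧
      ∀ v, G' (A.mulVec v) = U.mulVec (G v) + fun j => P j v := by
  obtain ⟨f, hf, hfM⟩ := h
  obtain ⟨B, hB⟩ := exists_tendsto_second_order hf.2.1 hf.1
  set L := fderiv ℂ f 0 with hL
  have hbij : Function.Bijective L := hf.bijective_fderiv
  let Lz : V p →ₗ[ℂ] V p × V p := (L : V p × V p →ₗ[ℂ] V p × V p) ∘ₗ LinearMap.inl ℂ _ _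
  let Lw : V p →ₗ[ℂ] V p × V p := (L : V p × V p →ₗ[ℂ] V p × V p) ∘ₗ LinearMap.inr ℂ _ _
  let A : V p →ₗ[ℂ] V p := LinearMap.fst ℂ _ _ ∘ₗ Lz
  let U : V p →ₗ[ℂ] V p := LinearMap.snd ℂ _ _ ∘ₗ Lw
  have key : ∀ v : V p, (L (v, 0)).2 = 0 ∧
      G' (L (v, 0)).1 = (L (0, G v)).2 + (B (v, 0) (v, 0)).2 := by
    intro v
    have h1 := (hB (v, 0) (0, G v)).comp tendsto_ofReal_punctured
    have hcurve : Tendsto (fun t : ℝ => ((t : ℂ) • v, (t : ℂ) ^ 2 • G v)) (𝓝[≠] 0)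
        (𝓝 (0 : V p × V p)) := by
      have : Continuous (fun t : ℝ => ((t : ℂ) • v, (t : ℂ) ^ 2 • G v)) := by fun_prop
      have h2 := (this.tendsto 0).mono_left (nhdsWithin_le_nhds (s := {0}ᶜ))
      have e : (((0 : ℝ) : ℂ) • v, ((0 : ℝ) : ℂ) ^ 2 • G v) = (0 : V p × V p) := by
        simp
      rwa [e] at h2
    have hmem : ∀ᶠ t : ℝ in 𝓝[≠] 0, (f ((t : ℂ) • v, (t : ℂ) ^ 2 • G v)).2 =
        G' (f ((t : ℂ) • v, (t : ℂ) ^ 2 • G v)).1 := by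
      filter_upwards [hcurve.eventually hfM] with t ht
      exact ht.1 (hG t v).symm
    have hcx : ∀ t : ℝ, ((t : ℂ) • (v, (0 : V p)) + (t : ℂ) ^ 2 • ((0 : V p), G v)) =
        ((t : ℂ) • v, (t : ℂ) ^ 2 • G v) := by
      intro t; simp
    simp only [Function.comp_def, hcx] at h1
    have htC : Tendsto (fun t : ℝ => (t : ℂ)) (𝓝[≠] 0) (𝓝 0) :=
      tendsto_ofReal_punctured.mono_right nhdsWithin_le_nhds
    have h3 : Tendsto (fun t : ℝ => (t : ℂ)⁻¹ • f ((t : ℂ) • v, (t : ℂ) ^ 2 • G v)) (𝓝[≠] 0)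
        (𝓝 (L (v, 0))) := by
      have := (htC.smul h1).add_const (L (v, 0))
      rw [zero_smul, zero_add] at this
      refine this.congr' ?_
      filter_upwards [self_mem_nhdsWithin] with t ht
      have ht : (t : ℂ) ≠ 0 := by simpa using ht
      rw [smul_smul, smul_sub, smul_smul]
      have e1 : (t : ℂ) * ((t : ℂ) ^ 2)⁻¹ = (t : ℂ)⁻¹ := by field_simp
      rw [e1, inv_mul_cancel₀ ht, one_smul, sub_add_cancel]
    have h4 : Tendsto (fun t : ℝ => ((t : ℂ) ^ 2)⁻¹ • (f ((t : ℂ) • v, (t : ℂ) ^ 2 • G v)).2)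
        (𝓝[≠] 0) (𝓝 (G' (L (v, 0)).1)) := by
      have := (hc.tendsto _).comp ((continuous_fst.tendsto _).comp h3)
      refine this.congr' ?_
      filter_upwards [hmem, self_mem_nhdsWithin] with t ht1 ht
      have ht : (t : ℂ) ≠ 0 := by simpa using ht
      rw [ht1]
      simp only [Function.comp_apply, Prod.smul_fst]
      have := hG' t⁻¹ (f ((t : ℂ) • v, (t : ℂ) ^ 2 • G v)).1
      rw [Complex.ofReal_inv, inv_pow] at this
      exact this
    -- The second component of the image is `G'` of the first, hence of order `t²`, so its
    -- first-order part vanishes.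
    have h5 : (L (v, 0)).2 = 0 := by
      have h6 := htC.smul h4
      rw [zero_smul] at h6
      refine tendsto_nhds_unique ((continuous_snd.tendsto _).comp h3) (h6.congr' ?_)
      filter_upwards [self_mem_nhdsWithin] with t ht
      have ht : (t : ℂ) ≠ 0 := by simpa using ht
      rw [smul_smul]
      simp only [Function.comp_apply, Prod.smul_snd]
      congr 1
      field_simp
    refine ⟨h5, tendsto_nhds_unique h4 ?_⟩
    have h7 := (continuous_snd.tendsto _).comp h1
    simp only [Function.comp_def, Prod.smul_snd, Prod.snd_sub, Prod.snd_add, h5, smul_zero,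
      sub_zero] at h7
    exact h7
  have hdec : ∀ x : V p × V p, L x = L (x.1, 0) + L (0, x.2) := by
    intro x
    rw [← map_add]
    simp
  refine ⟨LinearMap.toMatrix' A, LinearMap.toMatrix' U,
    fun j => LinearMap.BilinMap.toQuadraticMap
      ((B.compl₁₂ (LinearMap.inl ℂ (V p) (V p)) (LinearMap.inl ℂ (V p) (V p))).compr₂
        (LinearMap.proj (R := ℂ) (φ := fun _ : Fin p => ℂ) j ∘ₗ LinearMap.snd ℂ (V p) (V p))), ?_, ?_, ?_⟩
  · rw [← Matrix.mulVec_injective_iff_isUnit]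
    have : Function.Injective A := by
      rw [← LinearMap.ker_eq_bot, LinearMap.ker_eq_bot']
      intro v hv
      have : L (v, 0) = L 0 := by
        rw [map_zero]; exact Prod.ext hv (key v).1
      exact congrArg Prod.fst (hbij.1 this)
    intro x y hxy
    simp only [LinearMap.toMatrix'_mulVec] at hxy
    exact this hxy
  -- `L` is block triangular: `(v, 0)` contributes nothing to the second component, so `U` inherits
  -- surjectivity from `L`.
  · rw [← Matrix.mulVec_surjective_iff_isUnit]
    intro y
    obtain ⟨x, hx⟩ := hbij.2 (0, y)
    refine ⟨x.2, ?_⟩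
    rw [LinearMap.toMatrix'_mulVec]
    have := congrArg Prod.snd hx
    rw [hdec, Prod.snd_add, (key _).1, zero_add] at this
    exact this
  · intro v
    rw [LinearMap.toMatrix'_mulVec, LinearMap.toMatrix'_mulVec]
    exact (key v).2

theorem analyticAt_quadraticForm (P : QuadraticForm ℂ (V p)) (v : V p) : AnalyticAt ℂ P v := by
  let B := (QuadraticMap.associated (R := ℂ) P).toContinuousBilinearMap
  have h : AnalyticAt ℂ (fun x : V p => B x x) v :=
    AnalyticAt.comp (g := fun x : V p × V p => B x.1 x.2) (f := fun x : V p => (x, x))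
      (B.analyticAt_bilinear _) (analyticAt_id.prod analyticAt_id)
  refine h.congr (Eventually.of_forall fun x => ?_)
  exact QuadraticMap.associated_eq_self_apply ℂ P x

theorem analyticAt_mulVec (A : Matrix (Fin p) (Fin p) ℂ) (v : V p) :
    AnalyticAt ℂ (fun x : V p => A.mulVec x) v :=
  (LinearMap.toContinuousLinearMap (Matrix.toLin' A)).analyticAt v

theorem QuadraticEquiv.holEquiv {M N : Set (V p × V p)} (h : QuadraticEquiv M N) :
    HolEquiv M N := by
  obtain ⟨A, U, P, hA, hU, hMN⟩ := h
  have hP : ∀ v, AnalyticAt ℂ (fun x : V p => fun j => P j x) v := fun v =>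
    analyticAt_pi_iff.2 fun j => analyticAt_quadraticForm (P j) v
  have hA' := (Matrix.isUnit_iff_isUnit_det _).1 hA
  have hU' := (Matrix.isUnit_iff_isUnit_det _).1 hU
  refine ⟨fun z => (A.mulVec z.1, U.mulVec z.2 + fun j => P j z.1), ⟨?_, ?_,
    fun y => (A⁻¹.mulVec y.1, U⁻¹.mulVec (y.2 - fun j => P j (A⁻¹.mulVec y.1))), ?_, ?_,
      Eventually.of_forall fun x => ?_, Eventually.of_forall fun x => ?_⟩,
    Eventually.of_forall hMN⟩
  · ext <;> simp
  · exact ((analyticAt_mulVec A _).comp analyticAt_fst).prod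
      (((analyticAt_mulVec U _).comp analyticAt_snd).add ((hP _).comp analyticAt_fst))
  · have : (fun _ : Fin p => (0 : ℂ)) = 0 := rfl
    simp [this]
  · have h1 : AnalyticAt ℂ (fun y : V p × V p => A⁻¹.mulVec y.1) 0 :=
      (analyticAt_mulVec _ _).comp analyticAt_fst
    refine h1.prod ?_
    exact AnalyticAt.comp (g := fun x => U⁻¹.mulVec x)
      (f := fun y : V p × V p => y.2 - fun j => P j (A⁻¹.mulVec y.1)) (analyticAt_mulVec U⁻¹ _)
      (analyticAt_snd.sub (AnalyticAt.comp (g := fun x : V p => fun j => P j x) (hP _) h1))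
  · simp [Matrix.mulVec_mulVec, Matrix.nonsing_inv_mul _ hA', Matrix.nonsing_inv_mul _ hU']
  · simp [Matrix.mulVec_mulVec, Matrix.mul_nonsing_inv _ hA', Matrix.mul_nonsing_inv _ hU']

theorem quadraticEquiv_graph {G G' : V p → V p} {A U : Matrix (Fin p) (Fin p) ℂ}
    {P : Fin p → QuadraticForm ℂ (V p)} (hA : IsUnit A) (hU : IsUnit U)
    (h : ∀ v, G' (A.mulVec v) = U.mulVec (G v) + fun j => P j v) :
    QuadraticEquiv {z : V p × V p | z.2 = G z.1} {z : V p × V p | z.2 = G' z.1} := by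
  refine ⟨A, U, P, hA, hU, fun z => ?_⟩
  change z.2 = _ ↔ _ = _
  rw [h, add_left_inj]
  exact ⟨fun e => by rw [e], fun e => Matrix.mulVec_injective_iff_isUnit.2 hU e⟩

end CRQuadric

/-! ### Deck germs are linear commuting involutions. -/

namespace CRQuadric

section Germs

variable {X : Type*} [NormedAddCommGroup X] [NormedSpace ℂ X]

/-- A germ tangent to the identity and of finite order is the identity. -/
theorem eventually_eq_self_of_iterate [CompleteSpace X] {f : X → X} (hf : AnalyticAt ℂ f 0)
    (h0 : f 0 = 0) (hd : fderiv ℂ f 0 = ContinuousLinearMap.id ℂ X) {n : ℕ} (hn : n ≠ 0)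
    (hit : ∀ᶠ x in 𝓝 (0 : X), f^[n] x = x) : ∀ᶠ x in 𝓝 (0 : X), f x = x := by
  have hs : HasStrictFDerivAt f (ContinuousLinearMap.id ℂ X) 0 := hd ▸ hf.hasStrictFDerivAt
  have hsi : ∀ i, HasStrictFDerivAt f^[i] (ContinuousLinearMap.id ℂ X) 0 := by
    intro i
    have := HasStrictFDerivAt.iterate hs h0 i
    have e : (ContinuousLinearMap.id ℂ X) ^ i = ContinuousLinearMap.id ℂ X := one_pow i
    rwa [e] at this
  have hn' : (n : ℂ) ≠ 0 := Nat.cast_ne_zero.2 hn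
  -- The average of the iterates has derivative the identity, so it is locally injective; it is also
  -- invariant under `f`.
  have hL : HasStrictFDerivAt (fun x => (n : ℂ)⁻¹ • ∑ i ∈ Finset.range n, f^[i] x)
      ((ContinuousLinearEquiv.refl ℂ X : X ≃L[ℂ] X) : X →L[ℂ] X) 0 := by
    have h1 := (HasStrictFDerivAt.fun_sum (u := Finset.range n) fun i _ => hsi i).const_smul
      (n : ℂ)⁻¹
    refine h1.congr_fderiv ?_
    ext x
    simp [← Nat.cast_smul_eq_nsmul ℂ, smul_smul, hn']
  have hinv := hL.eventually_left_inverse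
  have ht : Tendsto f (𝓝 0) (𝓝 0) := by simpa [h0] using hf.continuousAt.tendsto
  filter_upwards [hinv, ht.eventually hinv, hit] with x h1 h2 h3
  have e : ∑ i ∈ Finset.range n, f^[i] (f x) = ∑ i ∈ Finset.range n, f^[i] x := by
    have h4 := Finset.sum_range_succ' (fun i => f^[i] x) n
    rw [Finset.sum_range_succ, h3] at h4
    simpa using h4.symm
  rw [← h2, e, h1]

theorem IsBiholGerm.iterate {f : X → X} (hf : IsBiholGerm f) (n : ℕ) : IsBiholGerm f^[n] := by
  induction n with
  | zero => exact isBiholGerm_id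
  | succ n ih => rw [Function.iterate_succ]; exact ih.comp hf

end Germs

variable {p : ℕ} {h : Fin p → LinearMap.BilinForm ℂ (V p)} {q : Fin p → QuadraticForm ℂ (V p)}

theorem quadE_smul (c : ℂ) (z w : V p) : quadE h q (c • z) (c • w) = c ^ 2 • quadE h q z w := by
  ext j
  simp [quadE, QuadraticMap.map_smul]
  ring

theorem continuous_quadE : Continuous fun x : V p × V p => quadE h q x.1 x.2 := by
  refine continuous_pi fun j => Continuous.add ?_ ?_
  · exact (LinearMap.toContinuousBilinearMap (h j)).continuous₂
  · have : Continuous (q j) := continuous_iff_continuousAt.2 fun v =>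
      (analyticAt_quadraticForm (q j) v).continuousAt
    exact this.comp continuous_snd

/-- The linear deck transformations of `π₁`. -/
def linearDecks (h : Fin p → LinearMap.BilinForm ℂ (V p)) (q : Fin p → QuadraticForm ℂ (V p)) :
    Set ((V p × V p) →L[ℂ] (V p × V p)) :=
  {L | ∀ x, proj1 h q (L x) = proj1 h q x}

theorem mem_linearDecks {L : (V p × V p) →L[ℂ] (V p × V p)} :
    L ∈ linearDecks h q ↔ ∀ x, (L x).1 = x.1 ∧ quadE h q x.1 (L x).2 = quadE h q x.1 x.2 := by
  refine forall_congr' fun x => ?_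
  change (_, _) = (_, _) ↔ _
  rw [Prod.mk.injEq]
  exact and_congr_right fun e => by rw [e]

theorem IsDeck.comp {f g : V p × V p → V p × V p} (hf : IsDeck h q f) (hg : IsDeck h q g) :
    IsDeck h q (f ∘ g) := by
  refine ⟨hf.1.comp hg.1, ?_⟩
  filter_upwards [hg.1.tendsto.eventually hf.2, hg.2] with x h1 h2
  rw [Function.comp_apply, h1, h2]

theorem IsDeck.iterate {f : V p × V p → V p × V p} (hf : IsDeck h q f) (n : ℕ) :
    IsDeck h q f^[n] := by
  induction n with
  | zero => exact ⟨isBiholGerm_id, by simp⟩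
  | succ n ih => rw [Function.iterate_succ]; exact ih.comp hf

/-- By homogeneity of `π₁`, the rescaled maps `t⁻¹ f(t x)` preserve `π₁` as well; let `t → 0`. -/
theorem IsDeck.fderiv_mem {f : V p × V p → V p × V p} (hf : IsDeck h q f) :
    fderiv ℂ f 0 ∈ linearDecks h q := by
  rw [mem_linearDecks]
  intro x
  set L := fderiv ℂ f 0
  have hd : HasFDerivAt f L 0 := hf.1.2.1.differentiableAt.hasFDerivAt
  have h1 := (hd.hasLineDerivAt x).tendsto_slope_zero
  simp only [zero_add, hf.1.1, sub_zero] at h1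
  have ht : Tendsto (fun t : ℂ => t • x) (𝓝[≠] 0) (𝓝 0) := by
    have : Continuous fun t : ℂ => t • x := by fun_prop
    simpa using (this.tendsto 0).mono_left (nhdsWithin_le_nhds (s := {0}ᶜ))
  have h2 := ht.eventually hf.2
  have h3 : ∀ᶠ t : ℂ in 𝓝[≠] 0, (t⁻¹ • f (t • x)).1 = x.1 ∧
      quadE h q (t⁻¹ • f (t • x)).1 (t⁻¹ • f (t • x)).2 = quadE h q x.1 x.2 := by
    filter_upwards [h2, self_mem_nhdsWithin] with t e ht
    have ht : t ≠ 0 := ht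
    have e1 : (f (t • x)).1 = t • x.1 := congrArg Prod.fst e
    have e2 : quadE h q (f (t • x)).1 (f (t • x)).2 = quadE h q (t • x.1) (t • x.2) :=
      congrArg Prod.snd e
    refine ⟨by rw [Prod.smul_fst, e1, smul_smul, inv_mul_cancel₀ ht, one_smul], ?_⟩
    rw [Prod.smul_fst, Prod.smul_snd, quadE_smul, e2, quadE_smul, smul_smul]
    have : t⁻¹ ^ 2 * t ^ 2 = 1 := by field_simp
    rw [this, one_smul]
  have e1 : (L x).1 = x.1 := by
    refine tendsto_nhds_unique ((continuous_fst.tendsto _).comp h1) ?_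
    exact tendsto_const_nhds.congr' (h3.mono fun t ht => ht.1.symm)
  refine ⟨e1, ?_⟩
  have e2 : quadE h q (L x).1 (L x).2 = quadE h q x.1 x.2 := by
    refine tendsto_nhds_unique ((continuous_quadE.tendsto (L x)).comp h1) ?_
    exact tendsto_const_nhds.congr' (h3.mono fun t ht => ht.2.symm)
  rwa [e1] at e2

theorem quadE_zero_left (w : V p) : quadE h q 0 w = fun j => q j w := by
  ext j; simp [quadE]

theorem injective_of_mem_linearDecks (hB : CondB q) {L : (V p × V p) →L[ℂ] (V p × V p)}
    (hL : L ∈ linearDecks h q) : Function.Injective L := by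
  rw [mem_linearDecks] at hL
  refine (injective_iff_map_eq_zero L).2 fun x hx => ?_
  obtain ⟨h1, h2⟩ := hL x
  rw [hx] at h1 h2
  have h1 : (0 : V p) = x.1 := h1
  rw [← h1, quadE_zero_left, quadE_zero_left] at h2
  refine Prod.ext h1.symm (hB _ fun j => ?_)
  have := congrFun h2 j
  simpa using this.symm

theorem isDeck_of_mem_linearDecks (hB : CondB q) {L : (V p × V p) →L[ℂ] (V p × V p)}
    (hL : L ∈ linearDecks h q) : IsDeck h q L := by
  let e := (LinearEquiv.ofInjectiveEndo (L : V p × V p →ₗ[ℂ] V p × V p)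
    (injective_of_mem_linearDecks hB hL)).toContinuousLinearEquiv
  have he : ∀ x, e x = L x := fun x => rfl
  refine ⟨⟨map_zero L, L.analyticAt 0, e.symm, map_zero _, e.symm.toContinuousLinearMap.analyticAt 0,
    Eventually.of_forall fun x => ?_, Eventually.of_forall fun x => ?_⟩, Eventually.of_forall hL⟩
  · rw [← he, e.symm_apply_apply]
  · rw [← he, e.apply_symm_apply]

/-- The germ `g⁻¹ ∘ f` is tangent to the identity, and its powers lie in a finite set of germs, so
two of them agree and it has finite order. -/
theorem IsDeck.eventuallyEq_of_fderiv_eq (hfin : (deckGerms h q).Finite)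
    {f g : V p × V p → V p × V p} (hf : IsDeck h q f) (hg : IsDeck h q g)
    (hfg : fderiv ℂ f 0 = fderiv ℂ g 0) : f =ᶠ[𝓝 0] g := by
  obtain ⟨g', hg', h1, h2⟩ := hg.1.exists_inverse
  have hg'd : IsDeck h q g' := by
    refine ⟨hg', ?_⟩
    filter_upwards [hg'.tendsto.eventually hg.2, h2] with x e1 e2
    rw [← e1, e2]
  have hk := hg'd.comp hf
  set k := g' ∘ f with hkdef
  have hkd : fderiv ℂ k 0 = ContinuousLinearMap.id ℂ _ := by
    rw [← fderiv_comp_eq_id hg.1.2.1 hg'.2.1 hg.1.1 h1, ← hfg]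
    refine HasFDerivAt.fderiv (HasFDerivAt.comp 0 ?_ hf.1.2.1.differentiableAt.hasFDerivAt)
    rw [hf.1.1]
    exact hg'.2.1.differentiableAt.hasFDerivAt
  have hmaps : ∀ n : ℕ, ((k^[n] : V p × V p → V p × V p) : Germ (𝓝 (0 : V p × V p)) (V p × V p)) ∈
      deckGerms h q := fun n => ⟨_, hk.iterate n, rfl⟩
  obtain ⟨i, j, hij, he⟩ := hfin.exists_lt_map_eq_of_forall_mem hmaps
  have he : k^[i] =ᶠ[𝓝 0] k^[j] := Germ.coe_eq.1 he
  obtain ⟨m, -, hm, -⟩ := (hk.1.iterate i).exists_inverse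
  have hit : ∀ᶠ x in 𝓝 (0 : V p × V p), k^[j - i] x = x := by
    filter_upwards [he, hm, (hk.1.iterate (j - i)).tendsto.eventually hm] with x e1 e2 e3
    rw [← e3, ← Function.iterate_add_apply, Nat.add_sub_cancel' hij.le, ← e1, e2]
  have hid := eventually_eq_self_of_iterate hk.1.2.1 hk.1.1 hkd (by omega) hit
  filter_upwards [hid, hf.1.tendsto.eventually h2] with x e1 e2
  have e1 : g' (f x) = x := e1
  rw [← e2, e1]

theorem coe_image_linearDecks (hB : CondB q) (hfin : (deckGerms h q).Finite) :
    (fun L : (V p × V p) →L[ℂ] (V p × V p) =>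
      ((L : V p × V p → V p × V p) : Germ (𝓝 (0 : V p × V p)) (V p × V p))) '' linearDecks h q =
      deckGerms h q := by
  refine Set.Subset.antisymm ?_ ?_
  · rintro _ ⟨L, hL, rfl⟩
    exact ⟨L, isDeck_of_mem_linearDecks hB hL, rfl⟩
  · rintro _ ⟨f, hf, rfl⟩
    refine ⟨fderiv ℂ f 0, hf.fderiv_mem, Germ.coe_eq.2 ?_⟩
    refine (isDeck_of_mem_linearDecks hB hf.fderiv_mem).eventuallyEq_of_fderiv_eq hfin hf ?_
    exact ContinuousLinearMap.fderiv _

theorem ncard_linearDecks (hD : CondD h q) : (linearDecks h q).ncard = 2 ^ p := by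
  have hfin : (deckGerms h q).Finite :=
    Set.finite_of_ncard_ne_zero (by rw [hD.2]; positivity)
  rw [← hD.2, ← coe_image_linearDecks hD.1 hfin, Set.InjOn.ncard_image]
  intro L _ K _ hLK
  have : (L : V p × V p → V p × V p) =ᶠ[𝓝 0] K := Germ.coe_eq.1 hLK
  have := this.fderiv_eq (𝕜 := ℂ)
  rwa [ContinuousLinearMap.fderiv, ContinuousLinearMap.fderiv] at this

theorem comp_mem_linearDecks {L K : (V p × V p) →L[ℂ] (V p × V p)}
    (hL : L ∈ linearDecks h q) (hK : K ∈ linearDecks h q) : L * K ∈ linearDecks h q :=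
  fun x => (hL (K x)).trans (hK x)

theorem pow_mem_linearDecks {L : (V p × V p) →L[ℂ] (V p × V p)}
    (hL : L ∈ linearDecks h q) (n : ℕ) : L ^ n ∈ linearDecks h q := by
  induction n with
  | zero => exact fun x => rfl
  | succ n ih => rw [pow_succ]; exact comp_mem_linearDecks ih hL

/-- A deck transformation fixes `z'`, so an eigenvector with `z' ≠ 0` has `μ = 1`. One in the fibre
satisfies `q(μ w) = q(w)` with `q(w) ≠ 0`. -/
theorem eq_one_or_neg_one_of_eigenvector (hB : CondB q) {L : (V p × V p) →L[ℂ] (V p × V p)}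
    (hL : L ∈ linearDecks h q) {μ : ℂ} {x : V p × V p} (hx : x ≠ 0) (hLx : L x = μ • x) :
    μ ^ 2 = 1 := by
  obtain ⟨h1, h2⟩ := mem_linearDecks.1 hL x
  rw [hLx] at h1 h2
  by_cases hx1 : x.1 = 0
  · rw [hx1, quadE_zero_left, quadE_zero_left] at h2
    by_contra hμ
    refine hx (Prod.ext hx1 (hB _ fun j => ?_))
    have h3 := congrFun h2 j
    simp only [Prod.smul_snd, QuadraticMap.map_smul, smul_eq_mul] at h3
    have : (μ ^ 2 - 1) * q j x.2 = 0 := by linear_combination h3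
    exact (mul_eq_zero.1 this).resolve_left (sub_ne_zero.2 hμ)
  · have : (μ - 1) • x.1 = 0 := by
      rw [sub_smul, one_smul, sub_eq_zero]; exact h1
    have := (smul_eq_zero.1 this).resolve_right hx1
    rw [sub_eq_zero.1 this, one_pow]

/-- Finite order makes `L` diagonalizable, since `X^n - 1` is separable, and its eigenvalues are
`±1`. -/
theorem mul_self_of_mem_linearDecks (hB : CondB q) (hfin : (linearDecks h q).Finite)
    {L : (V p × V p) →L[ℂ] (V p × V p)} (hL : L ∈ linearDecks h q) : L * L = 1 := by
  obtain ⟨i, j, hij, he⟩ := hfin.exists_lt_map_eq_of_forall_mem (pow_mem_linearDecks hL)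
  have hpow : L ^ (j - i) = 1 := by
    refine ContinuousLinearMap.ext fun x => ?_
    refine injective_of_mem_linearDecks hB (pow_mem_linearDecks hL i) ?_
    rw [← mul_apply_eq_comp, ← pow_add, Nat.add_sub_cancel' hij.le, ← he]
    rfl
  have hn : j - i ≠ 0 := by omega
  let T : Module.End ℂ (V p × V p) := L
  have hT : T ^ (j - i) = 1 := by
    have := congrArg (fun K : (V p × V p) →L[ℂ] (V p × V p) => (K : Module.End ℂ (V p × V p))) hpow
    simpa [T] using this
  have hss : T.IsSemisimple := by
    refine Module.End.isSemisimple_of_squarefree_aeval_eq_zero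
      (p := Polynomial.X ^ (j - i) - Polynomial.C 1) ?_ (by simp [hT])
    exact (Polynomial.separable_X_pow_sub_C (1 : ℂ) (Nat.cast_ne_zero.2 hn) one_ne_zero).squarefree
  have htop := T.iSup_maxGenEigenspace_eq_top
  simp_rw [hss.isFinitelySemisimple.maxGenEigenspace_eq_eigenspace] at htop
  have hle : ⨆ μ, T.eigenspace μ ≤ LinearMap.ker (T * T - 1) := by
    refine iSup_le fun μ x hx => ?_
    have hx : L x = μ • x := Module.End.mem_eigenspace_iff.1 hx
    by_cases hx0 : x = 0
    · simp [hx0]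
    have := eq_one_or_neg_one_of_eigenvector hB hL hx0 hx
    change L (L x) - x = 0
    rw [hx, map_smul, hx, smul_smul, ← pow_two, this, one_smul, sub_self]
  refine ContinuousLinearMap.ext fun x => ?_
  have : x ∈ LinearMap.ker (T * T - 1) := hle (by rw [htop]; trivial)
  exact sub_eq_zero.1 this

theorem exists_basis_joint_sign {ι M : Type*} [AddCommGroup M] [Module ℂ M] {p : ℕ}
    [FiniteDimensional ℂ M] (hp : Module.finrank ℂ M = p) (f : ι → Module.End ℂ M)
    (hcomm : ∀ i j, Commute (f i) (f j)) (hf : ∀ i, f i * f i = 1) :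
    ∃ b : Module.Basis (Fin p) ℂ M, ∀ i k, f i (b k) = b k ∨ f i (b k) = - b k := by
  have hss : ∀ i, (f i).IsSemisimple := fun i =>
    Module.End.isSemisimple_of_squarefree_aeval_eq_zero
      (p := Polynomial.X ^ 2 - Polynomial.C 1)
      (Polynomial.separable_X_pow_sub_C (1 : ℂ) two_ne_zero one_ne_zero).squarefree
      (by simp [pow_two, hf])
  have htop := Module.End.iSup_iInf_maxGenEigenspace_eq_top_of_iSup_maxGenEigenspace_eq_top_of_commute
    f (fun i j _ => hcomm i j) fun i => (f i).iSup_maxGenEigenspace_eq_top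
  simp_rw [(hss _).isFinitelySemisimple.maxGenEigenspace_eq_eigenspace] at htop
  rw [Submodule.iSup_eq_span] at htop
  let b₀ := Module.Basis.ofSpan htop.ge
  have := FiniteDimensional.fintypeBasisIndex b₀
  have hcard := (Module.finrank_eq_card_basis b₀).symm.trans hp
  let e := Fintype.equivFinOfCardEq hcard
  refine ⟨b₀.reindex e, fun i k => ?_⟩
  have hmem : b₀ (e.symm k) ∈ ⋃ χ : ι → ℂ, ((⨅ i, (f i).eigenspace (χ i) : Submodule ℂ M) : Set M) :=
    Module.Basis.ofSpan_subset htop.ge ⟨_, rfl⟩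
  rw [Module.Basis.reindex_apply]
  obtain ⟨χ, hχ⟩ := Set.mem_iUnion.1 hmem
  have hv : f i (b₀ (e.symm k)) = χ i • b₀ (e.symm k) :=
    Module.End.mem_eigenspace_iff.1 ((Submodule.mem_iInf _).1 hχ i)
  have h2 : (χ i ^ 2 - 1) • b₀ (e.symm k) = 0 := by
    have := LinearMap.congr_fun (hf i) (b₀ (e.symm k))
    rw [Module.End.mul_apply, hv, map_smul, hv, smul_smul, Module.End.one_apply] at this
    rw [sub_smul, one_smul, pow_two, this, sub_self]
  have h3 := (smul_eq_zero.1 h2).resolve_right (b₀.ne_zero _)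
  rcases eq_or_eq_neg_of_sq_eq_sq (χ i) 1 (by rw [sub_eq_zero.1 h3, one_pow]) with h | h
  · left; rw [hv, h, one_smul]
  · right; rw [hv, h, neg_one_smul]

end CRQuadric

/-! ### Simultaneous diagonalization of `q` and completion of the square. -/

namespace CRQuadric

variable {p : ℕ} {h : Fin p → LinearMap.BilinForm ℂ (V p)} {q : Fin p → QuadraticForm ℂ (V p)}

/-- The restriction of a linear deck transformation to the fibre `z' = 0`. -/
def fiberMap (L : (V p × V p) →L[ℂ] (V p × V p)) : Module.End ℂ (V p) :=
  LinearMap.snd ℂ (V p) (V p) ∘ₗ (L : V p × V p →ₗ[ℂ] V p × V p) ∘ₗ LinearMap.inr ℂ (V p) (V p)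

/-- The part of a linear deck transformation that depends on `z'`. -/
def baseMap (L : (V p × V p) →L[ℂ] (V p × V p)) : Module.End ℂ (V p) :=
  LinearMap.snd ℂ (V p) (V p) ∘ₗ (L : V p × V p →ₗ[ℂ] V p × V p) ∘ₗ LinearMap.inl ℂ (V p) (V p)

theorem apply_of_mem_linearDecks {L : (V p × V p) →L[ℂ] (V p × V p)} (hL : L ∈ linearDecks h q)
    (x : V p × V p) : L x = (x.1, baseMap L x.1 + fiberMap L x.2) := by
  refine Prod.ext (mem_linearDecks.1 hL x).1 ?_
  have : L x = L (x.1, 0) + L (0, x.2) := by rw [← map_add]; simp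
  rw [this]
  rfl

theorem map_fiberMap {L : (V p × V p) →L[ℂ] (V p × V p)} (hL : L ∈ linearDecks h q)
    (j : Fin p) (w : V p) : q j (fiberMap L w) = q j w := by
  have := (mem_linearDecks.1 hL (0, w)).2
  simp only [quadE_zero_left] at this
  exact congrFun this j

theorem fiberMap_mul {L K : (V p × V p) →L[ℂ] (V p × V p)} (hL : L ∈ linearDecks h q)
    (hK : K ∈ linearDecks h q) : fiberMap (L * K) = fiberMap L * fiberMap K := by
  refine LinearMap.ext fun w => ?_
  change (L (K (0, w))).2 = _
  rw [apply_of_mem_linearDecks hK, apply_of_mem_linearDecks hL]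
  simp

theorem fiberMap_one : fiberMap (1 : (V p × V p) →L[ℂ] (V p × V p)) = 1 := rfl

/-- The product `K L` has the form `(z, w) ↦ (z, β z + w)`; being an involution it satisfies `2 β =
0`. -/
theorem eq_of_fiberMap_eq (hB : CondB q) (hfin : (linearDecks h q).Finite)
    {L K : (V p × V p) →L[ℂ] (V p × V p)} (hL : L ∈ linearDecks h q) (hK : K ∈ linearDecks h q)
    (hLK : fiberMap L = fiberMap K) : L = K := by
  have hM := comp_mem_linearDecks hK hL
  set M := K * L with hMdef
  have hKK := mul_self_of_mem_linearDecks hB hfin hK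
  have hf : fiberMap M = 1 := by
    rw [hMdef, fiberMap_mul hK hL, hLK, ← fiberMap_mul hK hK, hKK, fiberMap_one]
  have hMM := mul_self_of_mem_linearDecks hB hfin hM
  have hb : ∀ z, baseMap M z = 0 := by
    intro z
    have h1 := DFunLike.congr_fun hMM (z, 0)
    rw [mul_apply_eq_comp] at h1
    simp only [apply_of_mem_linearDecks hM, hf] at h1
    have h2 := congrArg Prod.snd h1
    simp only [map_zero, add_zero, Module.End.one_apply] at h2
    have h3 : (2 : ℂ) • baseMap M z = 0 := by rw [two_smul]; exact h2
    exact (smul_eq_zero.1 h3).resolve_left two_ne_zero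
  have h1 : M = 1 := by
    refine ContinuousLinearMap.ext fun x => ?_
    rw [apply_of_mem_linearDecks hM, hf, hb, zero_add]
    rfl
  calc L = K * K * L := by rw [hKK, one_mul]
    _ = K := by rw [mul_assoc, ← hMdef, h1, mul_one]

/-- The fibre quadratic forms are simultaneously diagonal in some basis. -/
theorem exists_basis_sum_squares (hD : CondD h q) :
    ∃ b : Module.Basis (Fin p) ℂ (V p), ∀ j w, q j w = ∑ k, q j (b k) * (b.repr w k) ^ 2 := by
  have hB := hD.1
  have hcard := ncard_linearDecks hD
  have hfin : (linearDecks h q).Finite := Set.finite_of_ncard_ne_zero (by rw [hcard]; positivity)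
  have hcomm : ∀ L K : linearDecks h q, Commute (fiberMap L.1) (fiberMap K.1) := by
    intro L K
    have e1 := mul_self_of_mem_linearDecks hB hfin L.2
    have e2 := mul_self_of_mem_linearDecks hB hfin K.2
    have e3 := mul_self_of_mem_linearDecks hB hfin (comp_mem_linearDecks L.2 K.2)
    have e : L.1 * K.1 = K.1 * L.1 := by
      calc L.1 * K.1 = (K.1 * K.1) * (L.1 * K.1) := by rw [e2, one_mul]
        _ = K.1 * (L.1 * L.1) * K.1 * (L.1 * K.1) := by rw [e1, mul_one, mul_assoc]
        _ = K.1 * L.1 * (L.1 * K.1 * (L.1 * K.1)) := by simp only [mul_assoc]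
        _ = K.1 * L.1 := by rw [e3, mul_one]
    change _ * _ = _ * _
    rw [← fiberMap_mul L.2 K.2, e, fiberMap_mul K.2 L.2]
  have hsq : ∀ L : linearDecks h q, fiberMap L.1 * fiberMap L.1 = 1 := fun L => by
    rw [← fiberMap_mul L.2 L.2, mul_self_of_mem_linearDecks hB hfin L.2, fiberMap_one]
  obtain ⟨b, hb⟩ := exists_basis_joint_sign (p := p) (by simp)
    (fun L : linearDecks h q => fiberMap L.1) hcomm hsq
  have hbne : ∀ k, b k ≠ - b k := fun k e => b.ne_zero k (self_eq_neg.1 e)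
  -- The set of flipped basis vectors determines the deck transformation. There are `2^p` of each,
  -- so every subset occurs; singletons are the ones used.
  let φ : ((V p × V p) →L[ℂ] (V p × V p)) → Set (Fin p) := fun L => {k | fiberMap L (b k) = - b k}
  have hφ : Set.InjOn φ (linearDecks h q) := by
    intro L hL K hK hLK
    refine eq_of_fiberMap_eq hB hfin hL hK (b.ext fun k => ?_)
    have hk : fiberMap L (b k) = - b k ↔ fiberMap K (b k) = - b k := Set.ext_iff.1 hLK k
    rcases hb ⟨L, hL⟩ k with e | e <;> rcases hb ⟨K, hK⟩ k with e' | e' <;>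
      simp only at e e'
    · rw [e, e']
    · exact absurd (hk.2 e') (by rw [e]; exact hbne k)
    · exact absurd (hk.1 e) (by rw [e']; exact hbne k)
    · rw [e, e']
  have himg : φ '' linearDecks h q = Set.univ := by
    refine Set.eq_of_subset_of_ncard_le (Set.subset_univ _) ?_
    rw [hφ.ncard_image, hcard, Set.ncard_univ, Nat.card_eq_fintype_card, Fintype.card_set,
      Fintype.card_fin]
  refine ⟨b, fun j w => ?_⟩
  have horth : LinearMap.IsOrthoᵢ (QuadraticMap.associated (R := ℂ) (q j)) b := by
    intro k l hkl
    obtain ⟨L, hL, hLk⟩ : ({k} : Set (Fin p)) ∈ φ '' linearDecks h q := himg ▸ Set.mem_univ _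
    have e1 : fiberMap L (b k) = - b k := by
      have : k ∈ φ L := by rw [hLk]; rfl
      exact this
    have e2 : fiberMap L (b l) = b l := by
      refine (hb ⟨L, hL⟩ l).resolve_right fun e => hkl ?_
      have : l ∈ ({k} : Set (Fin p)) := hLk ▸ e
      exact this.symm
    -- Flipping `b k` alone preserves `q j`, which forces the polar form to vanish on `(b k, b l)`.
    have h1 : q j (b k + b l) = q j (- b k + b l) := by
      rw [← map_fiberMap hL j (b k + b l), map_add, e1, e2]
    change QuadraticMap.associated (R := ℂ) (q j) (b k) (b l) = 0
    rw [QuadraticMap.associated_apply, h1, ← QuadraticMap.map_neg (q j) (b k)]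
    have h2 := QuadraticMap.associated_apply ℂ (q j) (- b k) (b l)
    have h3 := QuadraticMap.associated_apply ℂ (q j) (b k) (b l)
    rw [map_neg, LinearMap.neg_apply, QuadraticMap.map_neg] at h2
    rw [h1] at h3
    rw [QuadraticMap.map_neg, ← h3]
    rw [← h3] at h2
    exact self_eq_neg.1 h2.symm
  have h1 := QuadraticMap.basisRepr_eq_of_iIsOrtho (q j) b horth
  have h2 := DFunLike.congr_fun h1 (⇑(b.repr w))
  rw [QuadraticMap.basisRepr_apply, b.sum_repr, QuadraticMap.weightedSumSquares_apply] at h2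
  rw [h2]
  exact Finset.sum_congr rfl fun k _ => by rw [smul_eq_mul, pow_two]

theorem exists_matrix_sum_squares (hD : CondD h q) :
    ∃ C S : Matrix (Fin p) (Fin p) ℂ, IsUnit C ∧ IsUnit S ∧
      ∀ w, (fun j => q j w) = C.mulVec fun k => (S.mulVec w k) ^ 2 := by
  obtain ⟨b, hb⟩ := exists_basis_sum_squares hD
  have hS : ∀ w k, (LinearMap.toMatrix' (b.equivFun : V p →ₗ[ℂ] V p)).mulVec w k = b.repr w k := by
    intro w k
    rw [LinearMap.toMatrix'_mulVec]
    rfl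
  refine ⟨Matrix.of fun j k => q j (b k), LinearMap.toMatrix' (b.equivFun : V p →ₗ[ℂ] V p),
    ?_, ?_, fun w => ?_⟩
  · rw [← Matrix.mulVec_injective_iff_isUnit]
    have h0 : ∀ c : V p, (Matrix.of fun j k => q j (b k)).mulVec c = 0 → c = 0 := by
      -- If `C c = 0`, the vector whose coordinates are square roots of the `c k` is a zero of `q`,
      -- so condition B gives `c = 0`.
      intro c hc
      choose x hx using fun k => IsAlgClosed.exists_pow_nat_eq (c k) (n := 2) two_pos
      have hr : ∀ k, b.repr (∑ k, x k • b k) k = x k := fun k => by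
        rw [b.repr_sum_self]
      have : ∑ k, x k • b k = 0 := by
        refine hD.1 _ fun j => ?_
        rw [hb]
        simp only [hr, hx]
        exact congrFun hc j
      funext k
      rw [← hx k, ← hr k, this]
      simp
    exact fun c d hcd => sub_eq_zero.1 (h0 _ (by rw [Matrix.mulVec_sub]; exact sub_eq_zero.2 hcd))
  · rw [← Matrix.mulVec_injective_iff_isUnit]
    intro x y hxy
    refine b.repr.injective (Finsupp.ext fun k => ?_)
    rw [← hS, ← hS]
    exact congrFun hxy k
  · funext j
    rw [hb]
    simp only [Matrix.mulVec, dotProduct, Matrix.of_apply]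
    refine Finset.sum_congr rfl fun k _ => ?_
    rw [← hS]
    rfl

/-- The differential of the straightening map sends `K` injectively into `W`, as a limit of
difference quotients that lie in `W`. -/
theorem IsSubmanifoldGerm.finrank_le {X : Type*} [NormedAddCommGroup X] [NormedSpace ℂ X]
    [FiniteDimensional ℂ X] {S : Set X} {d : ℕ} (hS : IsSubmanifoldGerm S d)
    {K : Submodule ℂ X} (hK : ∀ᶠ x in 𝓝 (0 : X), x ∈ K → x ∈ S) : Module.finrank ℂ K ≤ d := by
  obtain ⟨φ, W, hφ, hW, hS⟩ := hS
  have hinj : Function.Injective (fderiv ℂ φ 0) := hφ.bijective_fderiv.1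
  let F : X →ₗ[ℂ] X := fderiv ℂ φ 0
  have hmap : K.map F ≤ W := by
    rintro _ ⟨v, hv, rfl⟩
    have h1 := (hφ.2.1.differentiableAt.hasFDerivAt.hasLineDerivAt v).tendsto_slope_zero
    simp only [zero_add, hφ.1, sub_zero] at h1
    refine (Submodule.closed_of_finiteDimensional W).mem_of_tendsto h1 ?_
    have ht : Tendsto (fun t : ℂ => t • v) (𝓝[≠] 0) (𝓝 0) := by
      have : Continuous fun t : ℂ => t • v := by fun_prop
      simpa using (this.tendsto 0).mono_left (nhdsWithin_le_nhds (s := {0}ᶜ))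
    filter_upwards [ht.eventually hK, ht.eventually hS] with t h2 h3
    exact W.smul_mem _ (h3.1 (h2 (K.smul_mem t hv)))
  rw [← hW, (Submodule.equivMapOfInjective F hinj K).finrank_eq]
  exact Submodule.finrank_mono hmap

theorem star_mulVec_map (a : Matrix (Fin p) (Fin p) ℂ) (v : V p) :
    star (a.mulVec v) = (a.map star).mulVec (star v) := by
  funext i
  exact RingHom.map_mulVec (starRingEnd ℂ) a v i

/-- Here `(z, w) ↦ (z, a z - w)` is the linear form of `τ₁`, and `w = a z / 2` is its fixed space.
The last clause is the spectrum of `σ` written through `a`. -/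
theorem exists_normalization (hE : CondE h q) :
    ∃ (a C S : Matrix (Fin p) (Fin p) ℂ) (P : Fin p → QuadraticForm ℂ (V p)),
      IsUnit C ∧ IsUnit S ∧
      (∀ z w, quadE h q z w + (fun j => P j z) =
        C.mulVec fun k => (S.mulVec (w - (2⁻¹ : ℂ) • a.mulVec z) k) ^ 2) ∧
      {μ : ℂ | ∃ x : V p × V p, x ≠ 0 ∧ (a.map star).mulVec x.2 - x.1 = μ • x.1 ∧
        a.mulVec ((a.map star).mulVec x.2 - x.1) - x.2 = μ • x.2}.ncard = 2 * p := by
  obtain ⟨hD, τ, hτ, hsub, hspec⟩ := hE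
  have hB := hD.1
  have hfinG : (deckGerms h q).Finite :=
    Set.finite_of_ncard_ne_zero (by rw [hD.2]; positivity)
  have hfin : (linearDecks h q).Finite :=
    Set.finite_of_ncard_ne_zero (by rw [ncard_linearDecks hD]; positivity)
  set L := fderiv ℂ τ 0
  have hL : L ∈ linearDecks h q := hτ.fderiv_mem
  have hτL : τ =ᶠ[𝓝 0] L := hτ.eventuallyEq_of_fderiv_eq hfinG
    (isDeck_of_mem_linearDecks hB hL) (ContinuousLinearMap.fderiv _).symm
  have hLL : ∀ x, L (L x) = x := DFunLike.congr_fun (mul_self_of_mem_linearDecks hB hfin hL)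
  have hff : ∀ w, fiberMap L (fiberMap L w) = w := by
    intro w
    have := congrArg Prod.snd (hLL (0, w))
    simpa [apply_of_mem_linearDecks hL] using this
  have hfb : ∀ z, fiberMap L (baseMap L z) = - baseMap L z := by
    intro z
    have := congrArg Prod.snd (hLL (z, 0))
    simp only [apply_of_mem_linearDecks hL, map_zero, add_zero] at this
    exact eq_neg_of_add_eq_zero_right this
  -- A nonzero fixed vector `w₀` of the fibre map would give the fixed vectors `(z, β z / 2 + t
  -- w₀)`, with `β` the base map, a space of dimension `p + 1`.
  have hfix : ∀ w, fiberMap L w = w → w = 0 := by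
    intro w₀ hw₀
    by_contra hne
    let K : Submodule ℂ (V p × V p) := LinearMap.ker
      ((L : V p × V p →ₗ[ℂ] V p × V p) - LinearMap.id)
    have hK : ∀ x, x ∈ K ↔ L x = x := fun x => sub_eq_zero
    have h1 : Module.finrank ℂ K ≤ p := by
      refine hsub.finrank_le ?_
      filter_upwards [hτL] with x hx hxK
      exact hx.trans ((hK x).1 hxK)
    let F : V p × ℂ →ₗ[ℂ] V p × V p := LinearMap.prod (LinearMap.fst ℂ _ _)
      ((2⁻¹ : ℂ) • (baseMap L ∘ₗ LinearMap.fst ℂ _ _) +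
        (LinearMap.toSpanSingleton ℂ (V p) w₀) ∘ₗ LinearMap.snd ℂ _ _)
    have hF : ∀ x, F x = (x.1, (2⁻¹ : ℂ) • baseMap L x.1 + x.2 • w₀) := fun x => rfl
    have hFK : ∀ x, F x ∈ K := by
      intro x
      rw [hK, apply_of_mem_linearDecks hL, hF]
      refine Prod.ext rfl ?_
      simp only [map_add, map_smul, hw₀, hfb]
      module
    have hFinj : Function.Injective (F.codRestrict K hFK) := by
      rw [← LinearMap.ker_eq_bot, LinearMap.ker_eq_bot']
      intro x hx
      have hx : F x = 0 := congrArg Subtype.val hx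
      rw [hF] at hx
      have e1 : x.1 = 0 := congrArg Prod.fst hx
      have e2 : (2⁻¹ : ℂ) • baseMap L x.1 + x.2 • w₀ = 0 := congrArg Prod.snd hx
      rw [e1, map_zero, smul_zero, zero_add] at e2
      exact Prod.ext e1 ((smul_eq_zero.1 e2).resolve_right hne)
    have h2 := LinearMap.finrank_le_finrank_of_injective hFinj
    have h3 : Module.finrank ℂ (V p × ℂ) = p + 1 := by simp
    omega
  have hneg : ∀ w, fiberMap L w = - w := by
    intro w
    have := hfix (w + fiberMap L w) (by rw [map_add, hff, add_comm])
    exact eq_neg_of_add_eq_zero_right this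
  obtain ⟨C, S, hC, hS, hCS⟩ := exists_matrix_sum_squares hD
  set a := LinearMap.toMatrix' (baseMap L) with hadef
  have ha : ∀ z, a.mulVec z = baseMap L z := fun z => LinearMap.toMatrix'_mulVec _ _
  have hLa : ∀ x, L x = (x.1, a.mulVec x.1 - x.2) := by
    intro x
    rw [apply_of_mem_linearDecks hL, hneg, ha, sub_eq_add_neg]
  -- Invariance under `τ₁` says that `h j z w` is `-1/2` times the polar form of `q j` at `(a z,
  -- w)`, so adding `q j (a z) / 4` yields `q j (w - a z / 2)`.
  refine ⟨a, C, S, fun j => ((4⁻¹ : ℂ) • q j).comp (Matrix.toLin' a), hC, hS, fun z w => ?_, ?_⟩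
  · rw [← hCS]
    funext j
    have e : ∀ w, h j z (a.mulVec z - w) + q j (a.mulVec z - w) = h j z w + q j w := by
      intro w
      have := (mem_linearDecks.1 hL (z, w)).2
      rw [hLa] at this
      exact congrFun this j
    have hq : ∀ (c : ℂ) (u v : V p), q j (u - c • v) = q j u + c ^ 2 * q j v -
        c * QuadraticMap.polar (q j) u v := by
      intro c u v
      have := QuadraticMap.polar_smul_right (q j) (-c) u v
      rw [QuadraticMap.polar, QuadraticMap.map_smul, smul_eq_mul, smul_eq_mul, neg_smul,
        ← sub_eq_add_neg] at this
      linear_combination this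
    have e0 := e 0
    have e1 := e w
    have hq1 := hq 1 (a.mulVec z) w
    rw [one_smul] at hq1
    rw [hq1, map_sub] at e1
    simp only [sub_zero, map_zero, add_zero] at e0
    rw [hq, QuadraticMap.polar_comm (q j) w]
    simp only [quadE, Pi.add_apply, QuadraticMap.comp_apply, Matrix.toLin'_apply,
      smul_apply, smul_eq_mul]
    linear_combination (1 / 2 : ℂ) * e0 - (1 / 2 : ℂ) * e1
  · rw [← hspec]
    -- `τ₂` is `(z, w) ↦ (ā w - z, w)`, and `T` is its composition with `(z, w) ↦ (z, a z - w)`.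
    let T : (V p × V p) →L[ℂ] (V p × V p) := LinearMap.toContinuousLinearMap
      (LinearMap.prod
        (Matrix.toLin' (a.map star) ∘ₗ LinearMap.snd ℂ _ _ - LinearMap.fst ℂ _ _)
        (Matrix.toLin' a ∘ₗ (Matrix.toLin' (a.map star) ∘ₗ LinearMap.snd ℂ _ _ -
          LinearMap.fst ℂ _ _) - LinearMap.snd ℂ _ _))
    have hT : ∀ x, T x = ((a.map star).mulVec x.2 - x.1,
      a.mulVec ((a.map star).mulVec x.2 - x.1) - x.2) := fun x => rfl
    have hρ : Tendsto (rho0 : V p × V p → V p × V p) (𝓝 0) (𝓝 0) := by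
      have : Continuous (rho0 : V p × V p → V p × V p) := by
        unfold rho0; fun_prop
      have h0 : rho0 (0 : V p × V p) = 0 := by ext <;> simp [rho0]
      simpa [h0] using this.tendsto 0
    have hσ : sigma τ =ᶠ[𝓝 0] T := by
      have h1 := hρ.eventually hτL
      have h2 : Tendsto (fun x => rho0 (τ (rho0 x))) (𝓝 0) (𝓝 0) :=
        hρ.comp (hτ.1.tendsto.comp hρ)
      filter_upwards [h1, h2.eventually hτL] with x e1 e2
      change τ (rho0 (τ (rho0 x))) = _
      rw [e2, e1, hLa, hLa, hT]
      simp only [rho0, star_sub, star_mulVec_map, star_star]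
    rw [hσ.fderiv_eq (𝕜 := ℂ), ContinuousLinearMap.fderiv]
    congr 1
    ext μ
    constructor
    · rintro ⟨x, hx0, e1, e2⟩
      refine Module.End.hasEigenvalue_of_hasEigenvector (x := x)
        ⟨Module.End.mem_eigenspace_iff.2 ?_, hx0⟩
      change T x = μ • x
      rw [hT, e1] at *
      exact Prod.ext rfl e2
    · intro hμ
      obtain ⟨x, hx, hx0⟩ := Module.End.HasEigenvalue.exists_hasEigenvector hμ
      have hx : T x = μ • x := Module.End.mem_eigenspace_iff.1 hx
      rw [hT] at hx
      exact ⟨x, hx0, congrArg Prod.fst hx, congrArg Prod.snd hx⟩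

end CRQuadric

/-! ### From the spectrum of `σ` to that of `ā a`. -/

namespace CRQuadric

variable {p : ℕ}

/-- The set of eigenvalues of a complex matrix. -/
def eigSet (M : Matrix (Fin p) (Fin p) ℂ) : Set ℂ :=
  {μ | ∃ v : V p, v ≠ 0 ∧ M.mulVec v = μ • v}

theorem hasEigenvector_toLin' {M : Matrix (Fin p) (Fin p) ℂ} {μ : ℂ} {v : V p} (hv : v ≠ 0)
    (h : M.mulVec v = μ • v) : Module.End.HasEigenvector (Matrix.toLin' M) μ v :=
  ⟨Module.End.mem_eigenspace_iff.2 (by simpa using h), hv⟩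

theorem finite_eigSet (M : Matrix (Fin p) (Fin p) ℂ) : (eigSet M).Finite := by
  refine (Module.End.finite_hasEigenvalue (Matrix.toLin' M)).subset ?_
  rintro μ ⟨v, hv, h⟩
  exact Module.End.hasEigenvalue_of_hasEigenvector (hasEigenvector_toLin' hv h)

theorem linearIndependent_eigenvectors {ι : Type*} {M : Matrix (Fin p) (Fin p) ℂ} {l : ι → ℂ}
    (hl : Function.Injective l) {v : ι → V p} (hv : ∀ i, v i ≠ 0)
    (h : ∀ i, M.mulVec (v i) = l i • v i) : LinearIndependent ℂ v :=
  Module.End.eigenvectors_linearIndependent' (Matrix.toLin' M) l hl v fun i =>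
    hasEigenvector_toLin' (hv i) (h i)

theorem ncard_eigSet_le (M : Matrix (Fin p) (Fin p) ℂ) : (eigSet M).ncard ≤ p := by
  have := (finite_eigSet M).fintype
  choose v hv h using fun μ : eigSet M => μ.2
  have := (linearIndependent_eigenvectors Subtype.val_injective hv h).fintype_card_le_finrank
  rw [Set.ncard_eq_toFinset_card', Set.toFinset_card]
  simpa using this

/-- With `p` distinct eigenvalues there is an eigenbasis; it can be taken to contain `u`, and only
the coordinate of `v` along `u` survives. -/
theorem eigenvector_smul_of_ncard_eq {M : Matrix (Fin p) (Fin p) ℂ} (hM : (eigSet M).ncard = p)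
    {μ : ℂ} {u v : V p} (hu : u ≠ 0) (hMu : M.mulVec u = μ • u) (hMv : M.mulVec v = μ • v) :
    ∃ c : ℂ, v = c • u := by
  have := (finite_eigSet M).fintype
  choose w hw h using fun μ : eigSet M => μ.2
  classical
  let m : eigSet M := ⟨μ, u, hu, hMu⟩
  let w' := Function.update w m u
  have hw' : ∀ i, w' i ≠ 0 := by
    intro i
    by_cases hi : i = m
    · subst hi; simpa [w'] using hu
    · simpa [w', hi] using hw i
  have h' : ∀ i, M.mulVec (w' i) = i.1 • w' i := by
    intro i
    by_cases hi : i = m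
    · subst hi; simpa [w'] using hMu
    · simpa [w', hi] using h i
  have hli := linearIndependent_eigenvectors Subtype.val_injective hw' h'
  have hcard : Fintype.card (eigSet M) = Module.finrank ℂ (V p) := by
    rw [← Set.toFinset_card, ← Set.ncard_eq_toFinset_card', hM]
    simp
  have : Nonempty (eigSet M) := ⟨m⟩
  let b := basisOfLinearIndependentOfCardEqFinrank hli hcard
  have hb : ∀ i, b i = w' i := fun i => by simp [b]
  refine ⟨b.repr v m, ?_⟩
  have h0 : ∑ i, (b.repr v i * (i.1 - μ)) • b i = 0 := by
    have e1 : M.mulVec v = ∑ i, (b.repr v i * i.1) • b i := by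
      conv_lhs => rw [← b.sum_repr v]
      rw [← Matrix.toLin'_apply, map_sum]
      refine Finset.sum_congr rfl fun i _ => ?_
      rw [map_smul, Matrix.toLin'_apply, hb, h', smul_smul]
    have e2 : M.mulVec v = ∑ i, (b.repr v i * μ) • b i := by
      rw [hMv]
      conv_lhs => rw [← b.sum_repr v]
      rw [Finset.smul_sum]
      exact Finset.sum_congr rfl fun i _ => by rw [smul_smul, mul_comm]
    simp only [mul_sub, sub_smul, Finset.sum_sub_distrib]
    rw [← e1, ← e2, sub_self]
  have h1 := Fintype.linearIndependent_iff.1 b.linearIndependent _ h0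
  have hbm : b m = u := by simp [hb, w']
  conv_lhs => rw [← b.sum_repr v]
  rw [Finset.sum_eq_single m, hbm]
  · intro i _ hi
    have h2 := h1 i
    have h3 : i.1 - μ ≠ 0 := fun e => hi (Subtype.ext (sub_eq_zero.1 e))
    rw [(mul_eq_zero.1 h2).resolve_right h3, zero_smul]
  · simp

theorem isUnit_of_zero_notMem_eigSet {M : Matrix (Fin p) (Fin p) ℂ} (h : (0 : ℂ) ∉ eigSet M) :
    IsUnit M := by
  rw [← Matrix.mulVec_injective_iff_isUnit]
  intro x y hxy
  by_contra hne
  refine h ⟨x - y, sub_ne_zero.2 hne, ?_⟩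
  rw [Matrix.mulVec_sub, zero_smul]
  exact sub_eq_zero.2 hxy

/-- The eigenvalues of `σ` lie over those of `ā a` under `μ ↦ μ + 2 + μ⁻¹`. -/
theorem mem_eigSet_of_sigma {a : Matrix (Fin p) (Fin p) ℂ} {μ : ℂ} {x : V p × V p} (hx : x ≠ 0)
    (h1 : (a.map star).mulVec x.2 - x.1 = μ • x.1)
    (h2 : a.mulVec ((a.map star).mulVec x.2 - x.1) - x.2 = μ • x.2) :
    μ ≠ 0 ∧ μ + 2 + μ⁻¹ ∈ eigSet (a.map star * a) := by
  have e2 : μ • a.mulVec x.1 = (μ + 1) • x.2 := by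
    rw [h1, Matrix.mulVec_smul] at h2
    rw [add_smul, one_smul, ← h2, sub_add_cancel]
  have e1 : (a.map star).mulVec x.2 = (μ + 1) • x.1 := by
    rw [add_smul, one_smul, ← h1, sub_add_cancel]
  have hμ : μ ≠ 0 := by
    rintro rfl
    rw [zero_smul, zero_add, one_smul] at e2
    rw [← e2, Matrix.mulVec_zero, zero_add, one_smul] at e1
    exact hx (Prod.ext e1.symm e2.symm)
  refine ⟨hμ, ?_⟩
  -- In this degenerate case `μ = -1` and `ā x.2 = 0`, so `0` is an eigenvalue of `ā a` by
  -- singularity, without `x` supplying an eigenvector.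
  by_cases hx1 : x.1 = 0
  · have hx2 : x.2 ≠ 0 := fun e => hx (Prod.ext hx1 e)
    rw [hx1, Matrix.mulVec_zero, smul_zero] at e2
    have hm : μ = -1 := eq_neg_of_add_eq_zero_left ((smul_eq_zero.1 e2.symm).resolve_right hx2)
    rw [hx1, smul_zero] at e1
    by_contra hn
    have h0 : μ + 2 + μ⁻¹ = 0 := by rw [hm]; norm_num
    rw [h0] at hn
    have hu := isUnit_of_zero_notMem_eigSet hn
    rw [Matrix.isUnit_iff_isUnit_det, Matrix.det_mul] at hu
    have hu' := (Matrix.isUnit_iff_isUnit_det _).2 (isUnit_of_mul_isUnit_left hu)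
    exact hx2 (Matrix.mulVec_injective_iff_isUnit.2 hu' (e1.trans (Matrix.mulVec_zero _).symm))
  · refine ⟨x.1, hx1, ?_⟩
    have e3 : μ • (a.map star * a).mulVec x.1 = (μ + 1) ^ 2 • x.1 := by
      rw [← Matrix.mulVec_mulVec, ← Matrix.mulVec_smul, e2, Matrix.mulVec_smul, e1, smul_smul,
        pow_two]
    calc (a.map star * a).mulVec x.1 = μ⁻¹ • μ • (a.map star * a).mulVec x.1 := by
          rw [smul_smul, inv_mul_cancel₀ hμ, one_smul]
      _ = (μ + 2 + μ⁻¹) • x.1 := by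
          rw [e3, smul_smul]
          congr 1
          field_simp
          ring

theorem exists_add_inv_eq (κ : ℂ) : ∃ r : ℂ, r ≠ 0 ∧ r + 2 + r⁻¹ = κ := by
  obtain ⟨d, hd⟩ := IsAlgClosed.exists_pow_nat_eq ((κ - 2) ^ 2 - 4) (n := 2) two_pos
  have h1 : (κ - 2 + d) / 2 * ((κ - 2 - d) / 2) = 1 := by linear_combination -(1 / 4 : ℂ) * hd
  refine ⟨(κ - 2 + d) / 2, left_ne_zero_of_mul_eq_one h1, ?_⟩
  rw [inv_eq_of_mul_eq_one_right h1]
  ring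

/-- Each of at most `p` eigenvalues of `ā a` has at most two preimages under `μ ↦ μ + 2 + μ⁻¹`, and
the branch values `0` and `4` have one. Reaching `2p` leaves no room for a loss. -/
theorem eigSet_of_sigma {a : Matrix (Fin p) (Fin p) ℂ}
    (hcard : {μ : ℂ | ∃ x : V p × V p, x ≠ 0 ∧ (a.map star).mulVec x.2 - x.1 = μ • x.1 ∧
        a.mulVec ((a.map star).mulVec x.2 - x.1) - x.2 = μ • x.2}.ncard = 2 * p) :
    (eigSet (a.map star * a)).ncard = p ∧ (0 : ℂ) ∉ eigSet (a.map star * a) ∧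
      (4 : ℂ) ∉ eigSet (a.map star * a) := by
  set E := eigSet (a.map star * a) with hEdef
  have hEfin : E.Finite := finite_eigSet _
  have hEle : E.ncard ≤ p := ncard_eigSet_le _
  choose r hr0 hr using exists_add_inv_eq
  have hroot : ∀ {μ κ : ℂ}, μ ≠ 0 → μ + 2 + μ⁻¹ = κ → μ = r κ ∨ μ = (r κ)⁻¹ := by
    intro μ κ hμ h
    have h1 := hr κ
    have h2 := hr0 κ
    have : (μ - r κ) * (μ - (r κ)⁻¹) = 0 := by
      have e : μ + μ⁻¹ = r κ + (r κ)⁻¹ := by linear_combination h - h1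
      calc (μ - r κ) * (μ - (r κ)⁻¹) = μ * (μ - (r κ + (r κ)⁻¹)) + r κ * (r κ)⁻¹ := by ring
        _ = μ * (μ - (μ + μ⁻¹)) + 1 := by rw [e, mul_inv_cancel₀ h2]
        _ = 0 := by
          have := mul_inv_cancel₀ hμ
          linear_combination -this
    rcases mul_eq_zero.1 this with h | h
    · exact Or.inl (sub_eq_zero.1 h)
    · exact Or.inr (sub_eq_zero.1 h)
  -- `F` contains the values that may have two preimages: it is taken to be everything in order to
  -- count `E`, and the complement of a branch value in order to exclude that value.
  have hsub : ∀ F : Set ℂ, (∀ κ ∈ E, κ ∉ F → r κ = (r κ)⁻¹) →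
      {μ : ℂ | ∃ x : V p × V p, x ≠ 0 ∧ (a.map star).mulVec x.2 - x.1 = μ • x.1 ∧
        a.mulVec ((a.map star).mulVec x.2 - x.1) - x.2 = μ • x.2} ⊆
        r '' E ∪ (fun κ => (r κ)⁻¹) '' (E ∩ F) := by
    rintro F hF μ ⟨x, hx, h1, h2⟩
    obtain ⟨hμ, hmem⟩ := mem_eigSet_of_sigma hx h1 h2
    rcases hroot hμ rfl with h | h
    · exact Or.inl ⟨_, hmem, h.symm⟩
    · by_cases hκ : μ + 2 + μ⁻¹ ∈ F
      · exact Or.inr ⟨_, ⟨hmem, hκ⟩, h.symm⟩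
      · exact Or.inl ⟨_, hmem, (hF _ hmem hκ).trans h.symm⟩
  have hbound : ∀ F : Set ℂ, (∀ κ ∈ E, κ ∉ F → r κ = (r κ)⁻¹) →
      2 * p ≤ E.ncard + (E ∩ F).ncard := by
    intro F hF
    rw [← hcard]
    have hf2 := hEfin.inter_of_left F
    refine (Set.ncard_le_ncard (hsub F hF) ((hEfin.image _).union (hf2.image _))).trans ?_
    refine (Set.ncard_union_le _ _).trans ?_
    exact add_le_add (Set.ncard_image_le hEfin) (Set.ncard_image_le hf2)
  have hex : ∀ κ₀ : ℂ, r κ₀ = (r κ₀)⁻¹ → κ₀ ∉ E := by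
    intro κ₀ h0 hmem
    have h1 := hbound {κ₀}ᶜ (fun κ _ hκ => by
      have : κ = κ₀ := by simpa using hκ
      rwa [this])
    have h2 : (E ∩ {κ₀}ᶜ).ncard < E.ncard :=
      Set.ncard_lt_ncard ⟨Set.inter_subset_left, fun h => (h hmem).2 rfl⟩ hEfin
    omega
  refine ⟨?_, hex 0 ?_, hex 4 ?_⟩
  · have := hbound Set.univ (fun κ _ h => absurd (Set.mem_univ κ) h)
    rw [Set.inter_univ] at this
    omega
  · have h1 := hr 0
    have h2 := hr0 0
    field_simp at h1 ⊢
    -- The double preimage of `0` is `-1`; likewise that of `4` is `1`.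
    have : (r 0 + 1) ^ 2 = 0 := by linear_combination h1
    have := pow_eq_zero_iff two_ne_zero |>.1 this
    rw [eq_neg_of_add_eq_zero_left this]
    norm_num
  · have h1 := hr 4
    have h2 := hr0 4
    field_simp at h1 ⊢
    have : (r 4 - 1) ^ 2 = 0 := by linear_combination h1
    have := pow_eq_zero_iff two_ne_zero |>.1 this
    rw [sub_eq_zero.1 this]
    norm_num

theorem map_star_mul (a b : Matrix (Fin p) (Fin p) ℂ) :
    (a * b).map star = a.map star * b.map star :=
  Matrix.map_mul (f := starRingEnd ℂ)

theorem map_star_one : (1 : Matrix (Fin p) (Fin p) ℂ).map star = 1 :=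
  Matrix.map_one (starRingEnd ℂ) (map_zero _) (map_one _)

theorem isUnit_map_star {a : Matrix (Fin p) (Fin p) ℂ} (ha : IsUnit a) : IsUnit (a.map star) := by
  obtain ⟨b, hb⟩ := ha.exists_right_inv
  exact IsUnit.of_mul_eq_one (b.map star) (by rw [← map_star_mul, hb, map_star_one])

theorem eigSet_inv_eq {a b : Matrix (Fin p) (Fin p) ℂ} (hab : a * b = 1)
    (h0 : (0 : ℂ) ∉ eigSet (a.map star * a)) :
    eigSet (b * b.map star) = (fun μ => μ⁻¹) '' eigSet (a.map star * a) := by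
  have hba : b * a = 1 := mul_eq_one_comm.1 hab
  have e1 : (b * b.map star) * (a.map star * a) = 1 := by
    calc (b * b.map star) * (a.map star * a) = b * (b.map star * a.map star) * a := by
          simp only [mul_assoc]
      _ = 1 := by rw [← map_star_mul, hba, map_star_one, mul_one, hba]
  have e2 := mul_eq_one_comm.1 e1
  ext l
  constructor
  · rintro ⟨v, hv, h⟩
    have h3 : v = l • (a.map star * a).mulVec v := by
      rw [← Matrix.mulVec_smul, ← h, Matrix.mulVec_mulVec, e2, Matrix.one_mulVec]
    have hl : l ≠ 0 := by
      rintro rfl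
      rw [zero_smul] at h3
      exact hv h3
    refine ⟨l⁻¹, ⟨v, hv, ?_⟩, inv_inv l⟩
    conv_rhs => rw [h3, smul_smul, inv_mul_cancel₀ hl, one_smul]
  · rintro ⟨κ, ⟨v, hv, h⟩, rfl⟩
    have hκ : κ ≠ 0 := by
      rintro rfl
      exact h0 ⟨v, hv, h⟩
    refine ⟨v, hv, ?_⟩
    have h3 : v = κ • (b * b.map star).mulVec v := by
      rw [← Matrix.mulVec_smul, ← h, Matrix.mulVec_mulVec, e1, Matrix.one_mulVec]
    conv_rhs => rw [h3, smul_smul, inv_mul_cancel₀ hκ, one_smul]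

end CRQuadric

/-! ### Bishop roots and normalized eigenvectors of `b b̄`. -/

namespace CRQuadric

variable {p : ℕ}

/-- The relation between an eigenvalue `l` of `γ γ̄` and the corresponding Bishop invariant `g`. -/
def IsBishopRoot (l g : ℂ) : Prop :=
  (l.im = 0 ∧ ∃ x : ℝ, 0 < x ∧ g = x ∧ l = x ^ 2) ∨
  (l.im < 0 ∧ 1 / 2 < g.re ∧ 0 < g.im ∧ g * (1 - g) = l) ∨
  (0 < l.im ∧ g.re < 1 / 2 ∧ 0 < g.im ∧ g * (1 - g) = l)

/-- For nonreal `l` the two roots `g` and `1 - g` of `g (1 - g) = l` lie on opposite sides of `Re =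
1/2`; for real `l` the positive square root is unique. -/
theorem IsBishopRoot.unique {l g g' : ℂ} (h : IsBishopRoot l g) (h' : IsBishopRoot l g') :
    g = g' := by
  have hroots : ∀ {g g' : ℂ}, g * (1 - g) = l → g' * (1 - g') = l → g = g' ∨ g = 1 - g' := by
    intro g g' e e'
    have : (g - g') * (g - (1 - g')) = 0 := by linear_combination e' - e
    rcases mul_eq_zero.1 this with h | h
    · exact Or.inl (sub_eq_zero.1 h)
    · exact Or.inr (sub_eq_zero.1 h)
  rcases h with ⟨h0, x, hx, rfl, hl⟩ | ⟨h0, h1, h2, h3⟩ | ⟨h0, h1, h2, h3⟩ <;>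
    rcases h' with ⟨k0, y, hy, rfl, hl'⟩ | ⟨k0, k1, k2, k3⟩ | ⟨k0, k1, k2, k3⟩ <;>
    try linarith
  · rw [hl] at hl'
    have : x ^ 2 = y ^ 2 := by exact_mod_cast hl'
    rw [(pow_left_inj₀ hx.le hy.le two_ne_zero).1 this]
  · rcases hroots h3 k3 with e | e
    · exact e
    · rw [e] at h1
      simp only [Complex.sub_re, Complex.one_re] at h1
      linarith
  · rcases hroots h3 k3 with e | e
    · exact e
    · rw [e] at h1
      simp only [Complex.sub_re, Complex.one_re] at h1
      linarith

theorem IsBishopRoot.conj {l g : ℂ} (h : IsBishopRoot l g) (hl : l.im ≠ 0) :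
    IsBishopRoot (star l) (1 - star g) := by
  have e : ∀ {g : ℂ}, g * (1 - g) = l → (1 - star g) * (1 - (1 - star g)) = star l := by
    intro g e
    rw [← e, star_mul', star_sub, star_one]
    ring
  rcases h with ⟨h0, -⟩ | ⟨h0, h1, h2, h3⟩ | ⟨h0, h1, h2, h3⟩
  · exact absurd h0 hl
  · refine Or.inr (Or.inr ⟨?_, ?_, ?_, e h3⟩) <;>
      simp only [Complex.star_def, Complex.conj_im, Complex.sub_re, Complex.sub_im,
        Complex.one_re, Complex.one_im, Complex.conj_re] <;> linarith
  · refine Or.inr (Or.inl ⟨?_, ?_, ?_, e h3⟩) <;>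
      simp only [Complex.star_def, Complex.conj_im, Complex.sub_re, Complex.sub_im,
        Complex.one_re, Complex.one_im, Complex.conj_re] <;> linarith

theorem IsBishopRoot.ne_zero {l g : ℂ} (h : IsBishopRoot l g) : g ≠ 0 := by
  rcases h with ⟨-, x, hx, rfl, -⟩ | ⟨-, -, h, -⟩ | ⟨-, -, h, -⟩
  · exact_mod_cast hx.ne'
  · rintro rfl; simp at h
  · rintro rfl; simp at h

theorem exists_isBishopRoot {l : ℂ} (hl : l.im < 0) : ∃ g, IsBishopRoot l g := by
  obtain ⟨d, hd⟩ := IsAlgClosed.exists_pow_nat_eq (1 / 4 - l) (n := 2) two_pos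
  -- The root is `1/2 + d`; as `Im d² = -Im l > 0`, choosing `Re d > 0` also makes `Im d > 0`.
  have key : ∀ d : ℂ, d ^ 2 = 1 / 4 - l → 0 < d.re → ∃ g, IsBishopRoot l g := by
    intro d hd hre
    refine ⟨1 / 2 + d, Or.inr (Or.inl ⟨hl, ?_, ?_, by linear_combination -hd⟩)⟩
    · simpa using hre
    · have h1 := congrArg Complex.im hd
      have : (1 / 4 - l).im = - l.im := by simp
      rw [this, pow_two, Complex.mul_im] at h1
      have h2 : (1 / 2 + d).im = d.im := by simp
      rw [h2]
      nlinarith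
  have hne : d.re ≠ 0 := by
    intro h0
    have h1 := congrArg Complex.im hd
    have : (1 / 4 - l).im = - l.im := by simp
    rw [this, pow_two, Complex.mul_im, h0] at h1
    linarith
  rcases hne.lt_or_gt with h | h
  · exact key (-d) (by rw [neg_sq, hd]) (by simpa using h)
  · exact key d hd h

/-- Eigenvectors `v l` of `b b̄`, normalized with respect to `v ↦ b v̄`. -/
theorem exists_normalized_eigenvectors {b : Matrix (Fin p) (Fin p) ℂ}
    (hcard : (eigSet (b * b.map star)).ncard = p) (h0 : (0 : ℂ) ∉ eigSet (b * b.map star)) :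
    ∃ (v : ℂ → V p) (g : ℂ → ℂ), ∀ l ∈ eigSet (b * b.map star),
      v l ≠ 0 ∧ (b * b.map star).mulVec (v l) = l • v l ∧ IsBishopRoot l (g l) ∧
      star l ∈ eigSet (b * b.map star) ∧
      b.mulVec (star (v l)) = g (star l) • v (star l) := by
  set N := b * b.map star with hN
  have hbb : ∀ v : V p, b.mulVec (star (b.mulVec (star v))) = N.mulVec v := by
    intro v
    rw [star_mulVec_map, star_star, Matrix.mulVec_mulVec]
  have hswap : ∀ {l : ℂ} {v : V p}, N.mulVec v = l • v →
      N.mulVec (b.mulVec (star v)) = star l • b.mulVec (star v) := by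
    intro l v h
    rw [← hbb, hbb v, h, star_smul, Matrix.mulVec_smul]
  have hne : ∀ {l : ℂ} {v : V p}, l ∈ eigSet N → v ≠ 0 → N.mulVec v = l • v →
      b.mulVec (star v) ≠ 0 := by
    intro l v hl hv h e
    rw [← hbb, e, star_zero, Matrix.mulVec_zero] at h
    rcases smul_eq_zero.1 h.symm with e | e
    · exact h0 (e ▸ hl)
    · exact hv e
  have hstar : ∀ l ∈ eigSet N, star l ∈ eigSet N := by
    rintro l ⟨v, hv, h⟩
    exact ⟨_, hne ⟨v, hv, h⟩ hv h, hswap h⟩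
  have hstep : ∀ l : ℂ, ∃ (v : V p) (g : ℂ), l ∈ eigSet N → l.im ≤ 0 →
      v ≠ 0 ∧ N.mulVec v = l • v ∧ IsBishopRoot l g ∧
        (l.im = 0 → b.mulVec (star v) = g • v) := by
    intro l
    by_cases hmem : l ∈ eigSet N
    swap
    · exact ⟨0, 0, fun h => absurd h hmem⟩
    obtain ⟨u, hu, h⟩ := hmem
    by_cases him : l.im = 0
    · have hreal : star l = l := Complex.conj_eq_iff_im.2 him
      have h2 := hswap h
      rw [hreal] at h2
      obtain ⟨c, hc⟩ := eigenvector_smul_of_ncard_eq hcard hu h h2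
      have hc0 : c ≠ 0 := by
        rintro rfl
        rw [zero_smul] at hc
        exact hne ⟨u, hu, h⟩ hu h hc
      have hl : l = (‖c‖ : ℂ) ^ 2 := by
        have h3 := hbb u
        rw [h, hc, star_smul, Matrix.mulVec_smul, hc, smul_smul] at h3
        have h4 : star c * c = l := smul_left_injective ℂ hu h3
        rw [← h4, Complex.star_def, Complex.conj_mul']
      have hn : (‖c‖ : ℂ) ≠ 0 := by exact_mod_cast norm_ne_zero_iff.2 hc0
      -- Multiplying `u` by a unit `θ` changes `c` to `c θ̄ / θ`, which is `‖c‖` when `θ² = c /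
      -- ‖c‖`.
      obtain ⟨θ, hθ⟩ := IsAlgClosed.exists_pow_nat_eq (c / ‖c‖) (n := 2) two_pos
      have hθn : star θ * θ = 1 := by
        have h5 : ‖θ‖ ^ 2 = 1 := by
          rw [← norm_pow, hθ, norm_div, Complex.norm_real, norm_norm,
            div_self (norm_ne_zero_iff.2 hc0)]
        rw [Complex.star_def, Complex.conj_mul']
        exact_mod_cast h5
      have hθ0 : θ ≠ 0 := right_ne_zero_of_mul_eq_one hθn
      have hcθ : c = ‖c‖ * θ ^ 2 := by rw [hθ]; field_simp
      refine ⟨θ • u, ‖c‖, fun _ _ => ⟨smul_ne_zero hθ0 hu, ?_, Or.inl ⟨him, ‖c‖,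
        norm_pos_iff.2 hc0, rfl, hl⟩, fun _ => ?_⟩⟩
      · rw [Matrix.mulVec_smul, h, smul_comm]
      · rw [star_smul, Matrix.mulVec_smul, hc, smul_smul, smul_smul]
        congr 1
        conv_lhs => rw [hcθ]
        linear_combination (‖c‖ * θ : ℂ) * hθn
    · by_cases hlt : l.im < 0
      · obtain ⟨g, hg⟩ := exists_isBishopRoot hlt
        exact ⟨u, g, fun _ _ => ⟨hu, h, hg, fun e => absurd e him⟩⟩
      · exact ⟨0, 0, fun _ h => absurd (lt_of_le_of_ne h him) hlt⟩
  choose u g₀ hug using hstep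
  -- Vectors are chosen freely for `Im l < 0`, and those for `Im l > 0` are their images under `v ↦
  -- b v̄`, scaled by the prescribed root. The relation back then holds because `g₀ (1 - g₀) = l̄`
  -- at `l̄`.
  let g : ℂ → ℂ := fun l => if 0 < l.im then 1 - star (g₀ (star l)) else g₀ l
  let v : ℂ → V p := fun l => if 0 < l.im then (g l)⁻¹ • b.mulVec (star (u (star l))) else u l
  have him : ∀ l : ℂ, (star l).im = - l.im := fun l => Complex.conj_im l
  have hg : ∀ l ∈ eigSet N, IsBishopRoot l (g l) := by
    intro l hl
    by_cases hlt : 0 < l.im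
    · have h1 := (hug (star l) (hstar l hl) (by rw [him]; linarith)).2.2.1.conj
        (by rw [him]; linarith)
      rw [star_star] at h1
      simpa [g, hlt] using h1
    · simpa [g, hlt] using (hug l hl (not_lt.1 hlt)).2.2.1
  refine ⟨v, g, fun l hl => ?_⟩
  have hsl := hstar l hl
  by_cases hlt : 0 < l.im
  · have hsn : ¬ 0 < (star l).im := by rw [him]; linarith
    obtain ⟨h1, h2, h3, -⟩ := hug (star l) hsl (not_lt.1 hsn)
    have hvl : v l = (g l)⁻¹ • b.mulVec (star (u (star l))) := by simp only [v, if_pos hlt]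
    have hvs : v (star l) = u (star l) := by simp only [v, if_neg hsn]
    have hgs : g (star l) = g₀ (star l) := by simp only [g, if_neg hsn]
    have hgl : g l = 1 - star (g₀ (star l)) := by simp only [g, if_pos hlt]
    have hgl0 := (hg l hl).ne_zero
    have h4 := hswap h2
    rw [star_star] at h4
    refine ⟨?_, ?_, hg l hl, hsl, ?_⟩
    · rw [hvl]
      exact smul_ne_zero (inv_ne_zero hgl0) (hne hsl h1 h2)
    · rw [hvl, Matrix.mulVec_smul, h4, smul_comm]
    · rw [hvl, star_smul, Matrix.mulVec_smul, hbb, h2, hvs, smul_smul, hgs]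
      congr 1
      have hroot : g₀ (star l) * (1 - g₀ (star l)) = star l := by
        rcases h3 with ⟨e, -⟩ | ⟨-, -, -, e⟩ | ⟨e, -⟩
        · rw [him] at e; linarith
        · exact e
        · exact absurd e hsn
      have hsg : star (g l) = 1 - g₀ (star l) := by
        rw [hgl, star_sub, star_one, star_star]
      have hne' : star (g l) ≠ 0 := star_ne_zero.2 hgl0
      rw [hsg] at hne'
      rw [star_inv₀, hsg, inv_mul_eq_iff_eq_mul₀ hne', mul_comm]
      exact hroot.symm
  · obtain ⟨h1, h2, h3, h4⟩ := hug l hl (not_lt.1 hlt)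
    have hvl : v l = u l := by simp only [v, if_neg hlt]
    refine ⟨hvl ▸ h1, by rw [hvl, h2], hg l hl, hsl, ?_⟩
    by_cases h5 : l.im = 0
    · have hreal : star l = l := Complex.conj_eq_iff_im.2 h5
      have hgl : g l = g₀ l := by simp only [g, if_neg hlt]
      rw [hreal, hgl, hvl, h4 h5]
    · have hpos : 0 < (star l).im := by
        rw [him]
        have := lt_of_le_of_ne (not_lt.1 hlt) h5
        linarith
      have hvs : v (star l) = (g (star l))⁻¹ • b.mulVec (star (u l)) := by
        simp only [v, if_pos hpos, star_star]
      rw [hvs, smul_smul, mul_inv_cancel₀ (hg _ hsl).ne_zero, one_smul, hvl]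

namespace BishopData

/-- The diagonal entries of `γ γ̄`. -/
def lam (D : BishopData p) (j : Fin p) : ℂ := D.γ j * star (D.γ (D.partner j))

theorem partner_of_lt (D : BishopData p) {j : Fin p} (h : j.val < D.e + D.h) :
    D.partner j = j := if_pos h

theorem partner_of_mid (D : BishopData p) {j : Fin p} (h1 : D.e + D.h ≤ j.val)
    (h2 : j.val < D.e + D.h + D.s) : (D.partner j).val = j.val + D.s := by
  unfold partner
  rw [if_neg (by omega), dif_pos h2]

theorem partner_of_ge (D : BishopData p) {j : Fin p} (h1 : D.e + D.h + D.s ≤ j.val) :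
    (D.partner j).val = j.val - D.s := by
  unfold partner
  rw [if_neg (by omega), dif_neg (by omega)]

theorem partner_partner (D : BishopData p) (j : Fin p) : D.partner (D.partner j) = j := by
  by_cases h1 : j.val < D.e + D.h
  · rw [D.partner_of_lt h1, D.partner_of_lt h1]
  · have := D.card_eq
    have := j.isLt
    by_cases h2 : j.val < D.e + D.h + D.s
    · have h3 := D.partner_of_mid (not_lt.1 h1) h2
      refine Fin.ext ?_
      rw [D.partner_of_ge (by omega)]
      omega
    · have h3 := D.partner_of_ge (not_lt.1 h2)
      refine Fin.ext ?_
      rw [D.partner_of_mid (by omega) (by omega)]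
      omega

theorem lam_partner (D : BishopData p) (j : Fin p) : D.lam (D.partner j) = star (D.lam j) := by
  rw [lam, lam, partner_partner, star_mul', star_star, mul_comm]

theorem mat_mulVec (D : BishopData p) (w : V p) (j : Fin p) :
    D.mat.mulVec w j = D.γ j * w (D.partner j) := by
  simp [mat, Matrix.mulVec, dotProduct]

theorem mul_mat_apply (D : BishopData p) (M : Matrix (Fin p) (Fin p) ℂ) (i j : Fin p) :
    (M * D.mat) i j = M i (D.partner j) * D.γ (D.partner j) := by
  rw [Matrix.mul_apply, Finset.sum_eq_single (D.partner j)]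
  · simp [mat, partner_partner]
  · intro k _ hk
    have : j ≠ D.partner k := fun e => hk (by rw [e, partner_partner])
    simp [mat, this]
  · simp

theorem mat_mul_apply (D : BishopData p) (M : Matrix (Fin p) (Fin p) ℂ) (i j : Fin p) :
    (D.mat * M) i j = D.γ i * M (D.partner i) j := by
  simp [mat, Matrix.mul_apply]

/-- This is what lets `γ j` be recovered from the diagonal entry of `γ γ̄`: that entry is `γ²` for
real components and `γ (1 - γ)` for complex ones. -/
theorem isBishopRoot (D : BishopData p) (j : Fin p) : IsBishopRoot (D.lam j) (D.γ j) := by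
  have hreal : j.val < D.e + D.h → ∀ x : ℝ, D.γ j = x → 0 < x →
      IsBishopRoot (D.lam j) (D.γ j) := by
    intro hj x hx h0
    have : D.lam j = (x : ℂ) ^ 2 := by
      rw [lam, D.partner_of_lt hj, hx, Complex.star_def, Complex.conj_ofReal, pow_two]
    refine Or.inl ⟨?_, x, h0, hx, this⟩
    rw [this, ← Complex.ofReal_pow, Complex.ofReal_im]
  have hcplx : ∀ j : Fin p, D.e + D.h ≤ j.val → j.val < D.e + D.h + D.s →
      IsBishopRoot (D.lam j) (D.γ j) := by
    intro j h1 h2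
    obtain ⟨h3, h4⟩ := D.cplx j h1 h2
    have hl : D.γ j * (1 - D.γ j) = D.lam j := by
      rw [lam, D.cplx' j _ h1 h2 (D.partner_of_mid h1 h2), star_sub, star_one, star_star]
    refine Or.inr (Or.inl ⟨?_, h3, h4, hl⟩)
    rw [← hl, Complex.mul_im]
    simp only [Complex.sub_re, Complex.sub_im, Complex.one_re, Complex.one_im]
    nlinarith
  by_cases h1 : j.val < D.e
  · obtain ⟨x, hx, h0, -⟩ := D.elliptic j h1
    exact hreal (by omega) x hx h0
  by_cases h2 : j.val < D.e + D.h
  · obtain ⟨x, hx, h0⟩ := D.hyperbolic j (not_lt.1 h1) h2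
    exact hreal h2 x hx (by linarith)
  by_cases h3 : j.val < D.e + D.h + D.s
  · exact hcplx j (not_lt.1 h2) h3
  · have hc := D.card_eq
    have hj := j.isLt
    have h4 := D.partner_of_ge (not_lt.1 h3)
    have h5 : D.e + D.h ≤ (D.partner j).val := by omega
    have h6 : (D.partner j).val < D.e + D.h + D.s := by omega
    have h7 := hcplx _ h5 h6
    have h8 : D.γ j = 1 - star (D.γ (D.partner j)) := D.cplx' _ j h5 h6 (by omega)
    have h9 : (D.lam (D.partner j)).im ≠ 0 := by
      obtain ⟨k1, k2⟩ := D.cplx _ h5 h6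
      rcases h7 with ⟨e, x, -, h, -⟩ | ⟨e, -⟩ | ⟨e, -⟩
      · rw [h, Complex.ofReal_im] at k2; exact absurd k2 (lt_irrefl _)
      · exact e.ne
      · exact e.ne'
    have h10 := h7.conj h9
    rwa [← D.lam_partner, D.partner_partner, ← h8] at h10

theorem γ_ne_zero (D : BishopData p) (j : Fin p) : D.γ j ≠ 0 := (D.isBishopRoot j).ne_zero

theorem isUnit_mat (D : BishopData p) : IsUnit D.mat := by
  rw [← Matrix.mulVec_injective_iff_isUnit]
  intro x y hxy
  funext j
  have := congrFun hxy (D.partner j)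
  rw [mat_mulVec, mat_mulVec, partner_partner] at this
  exact mul_left_cancel₀ (D.γ_ne_zero _) this

end BishopData

end CRQuadric

/-! ### Normal form under `b ↦ A⁻¹ b Ā`. -/

namespace CRQuadric

variable {p : ℕ}

/-- Bishop data can be arranged from a finite set of eigenvalues closed under conjugation. -/
theorem exists_bishopData_of_roots {E : Finset ℂ} (hcard : E.card = p)
    (hstar : ∀ l ∈ E, star l ∈ E) (hquarter : (1 / 4 : ℂ) ∉ E) {g : ℂ → ℂ}
    (hg : ∀ l ∈ E, IsBishopRoot l (g l)) :
    ∃ (D : BishopData p) (l : Fin p → ℂ), Function.Injective l ∧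
      ∀ j, l j ∈ E ∧ l (D.partner j) = star (l j) ∧ D.γ j = g (l j) := by
  classical
  -- Real `l` have `γ = √l`, so the threshold `1/4` for `l` is `1/2` for `γ`.
  let E₁ := E.filter fun l => l.im = 0 ∧ l.re < 1 / 4
  let E₂ := E.filter fun l => l.im = 0 ∧ ¬ l.re < 1 / 4
  let E₃ := E.filter fun l => l.im < 0
  let E₄ := E.filter fun l => 0 < l.im
  have him : ∀ l : ℂ, (star l).im = - l.im := fun l => Complex.conj_im l
  have h34 : E₄.card = E₃.card := by
    refine Finset.card_bij (fun l _ => star l) ?_ ?_ ?_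
    · intro l hl
      rw [Finset.mem_filter] at hl ⊢
      exact ⟨hstar l hl.1, by rw [him]; linarith [hl.2]⟩
    · intro a _ b _ hab
      exact star_injective hab
    · intro l hl
      rw [Finset.mem_filter] at hl
      refine ⟨star l, Finset.mem_filter.2 ⟨hstar l hl.1, by rw [him]; linarith [hl.2]⟩, star_star l⟩
  have hsum : E₁.card + E₂.card + 2 * E₃.card = p := by
    have e1 := Finset.card_filter_add_card_filter_not (s := E) fun l : ℂ => l.im = 0
    have e2 := Finset.card_filter_add_card_filter_not (s := E.filter fun l : ℂ => l.im = 0)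
      fun l : ℂ => l.re < 1 / 4
    have e3 := Finset.card_filter_add_card_filter_not (s := E.filter fun l : ℂ => ¬ l.im = 0)
      fun l : ℂ => l.im < 0
    rw [Finset.filter_filter, Finset.filter_filter] at e2 e3
    have e4 : (E.filter fun l : ℂ => ¬ l.im = 0 ∧ l.im < 0) = E₃ :=
      Finset.filter_congr fun l _ => ⟨fun h => h.2, fun h => ⟨h.ne, h⟩⟩
    have e5 : (E.filter fun l : ℂ => ¬ l.im = 0 ∧ ¬ l.im < 0) = E₄ :=
      Finset.filter_congr fun l _ => ⟨fun h => lt_of_le_of_ne (not_lt.1 h.2) (Ne.symm h.1),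
        fun h => ⟨h.ne', not_lt.2 h.le⟩⟩
    rw [e4, e5] at e3
    change E₁.card + E₂.card = _ at e2
    omega
  let l : Fin p → ℂ := fun j =>
    if h₁ : j.val < E₁.card then (E₁.equivFin.symm ⟨j.val, h₁⟩).1
    else if h₂ : j.val < E₁.card + E₂.card then
      (E₂.equivFin.symm ⟨j.val - E₁.card, by omega⟩).1
    else if h₃ : j.val < E₁.card + E₂.card + E₃.card then
      (E₃.equivFin.symm ⟨j.val - (E₁.card + E₂.card), by omega⟩).1
    else star (E₃.equivFin.symm ⟨j.val - (E₁.card + E₂.card + E₃.card), by omega⟩).1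
  have l₁ : ∀ j : Fin p, (h : j.val < E₁.card) → l j = (E₁.equivFin.symm ⟨j.val, h⟩).1 :=
    fun j h => dif_pos h
  have l₂ : ∀ j : Fin p, (h' : E₁.card ≤ j.val) → (h : j.val < E₁.card + E₂.card) →
      l j = (E₂.equivFin.symm ⟨j.val - E₁.card, by omega⟩).1 := by
    intro j h h'
    simp only [l]
    rw [dif_neg (by omega), dif_pos h']
  have l₃ : ∀ j : Fin p, (h' : E₁.card + E₂.card ≤ j.val) →
      (h : j.val < E₁.card + E₂.card + E₃.card) →
      l j = (E₃.equivFin.symm ⟨j.val - (E₁.card + E₂.card), by omega⟩).1 := by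
    intro j h h'
    simp only [l]
    rw [dif_neg (by omega), dif_neg (by omega), dif_pos h']
  have l₄ : ∀ j : Fin p, (h' : E₁.card + E₂.card + E₃.card ≤ j.val) →
      l j = star (E₃.equivFin.symm ⟨j.val - (E₁.card + E₂.card + E₃.card), by omega⟩).1 := by
    intro j h
    simp only [l]
    rw [dif_neg (by omega), dif_neg (by omega), dif_neg (by omega)]
  have m₁ : ∀ j : Fin p, j.val < E₁.card → l j ∈ E₁ := fun j h => by
    rw [l₁ j h]; exact Subtype.property _
  have m₂ : ∀ j : Fin p, E₁.card ≤ j.val → j.val < E₁.card + E₂.card → l j ∈ E₂ :=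
    fun j h h' => by rw [l₂ j h h']; exact Subtype.property _
  have m₃ : ∀ j : Fin p, E₁.card + E₂.card ≤ j.val → j.val < E₁.card + E₂.card + E₃.card →
      l j ∈ E₃ := fun j h h' => by rw [l₃ j h h']; exact Subtype.property _
  have mE : ∀ j, l j ∈ E := by
    intro j
    by_cases h1 : j.val < E₁.card
    · exact Finset.filter_subset _ _ (m₁ j h1)
    by_cases h2 : j.val < E₁.card + E₂.card
    · exact Finset.filter_subset _ _ (m₂ j (not_lt.1 h1) h2)
    by_cases h3 : j.val < E₁.card + E₂.card + E₃.card
    · exact Finset.filter_subset _ _ (m₃ j (not_lt.1 h2) h3)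
    · rw [l₄ j (not_lt.1 h3)]
      exact hstar _ (Finset.filter_subset _ _ (Subtype.property _))
  have hsurj : Function.Surjective fun j => (⟨l j, mE j⟩ : E) := by
    have idx : ∀ {F : Finset ℂ} {x : ℂ} (hx : x ∈ F) (n : Fin F.card),
        n.val = (F.equivFin ⟨x, hx⟩).val → (F.equivFin.symm n).1 = x := by
      intro F x hx n hn
      have : n = F.equivFin ⟨x, hx⟩ := Fin.ext hn
      rw [this, Equiv.symm_apply_apply]
    rintro ⟨x, hx⟩
    rcases lt_trichotomy x.im 0 with h | h | h
    · have hx' : x ∈ E₃ := Finset.mem_filter.2 ⟨hx, h⟩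
      have hn := (E₃.equivFin ⟨x, hx'⟩).isLt
      refine ⟨⟨E₁.card + E₂.card + (E₃.equivFin ⟨x, hx'⟩).val, by omega⟩, Subtype.ext ?_⟩
      simp only
      rw [l₃ _ (by simp) (by simp)]
      exact idx hx' _ (by simp)
    · by_cases hq : x.re < 1 / 4
      · have hx' : x ∈ E₁ := Finset.mem_filter.2 ⟨hx, h, hq⟩
        have hn := (E₁.equivFin ⟨x, hx'⟩).isLt
        refine ⟨⟨(E₁.equivFin ⟨x, hx'⟩).val, by omega⟩, Subtype.ext ?_⟩
        simp only
        rw [l₁ _ (by simp)]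
        exact idx hx' _ (by simp)
      · have hx' : x ∈ E₂ := Finset.mem_filter.2 ⟨hx, h, hq⟩
        have hn := (E₂.equivFin ⟨x, hx'⟩).isLt
        refine ⟨⟨E₁.card + (E₂.equivFin ⟨x, hx'⟩).val, by omega⟩, Subtype.ext ?_⟩
        simp only
        rw [l₂ _ (by simp) (by simp)]
        exact idx hx' _ (by simp)
    · have hx' : star x ∈ E₃ := Finset.mem_filter.2 ⟨hstar x hx, by rw [him]; linarith⟩
      have hn := (E₃.equivFin ⟨star x, hx'⟩).isLt
      refine ⟨⟨E₁.card + E₂.card + E₃.card + (E₃.equivFin ⟨star x, hx'⟩).val, by omega⟩,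
        Subtype.ext ?_⟩
      simp only
      rw [l₄ _ (by simp)]
      rw [idx hx' _ (by simp), star_star]
  have hinj : Function.Injective l := by
    have hb := (Fintype.bijective_iff_surjective_and_card
      (fun j => (⟨l j, mE j⟩ : E))).2 ⟨hsurj, by simp [hcard]⟩
    intro i j hij
    exact hb.1 (Subtype.ext hij)
  have hshift : ∀ j k : Fin p, E₁.card + E₂.card ≤ j.val →
      j.val < E₁.card + E₂.card + E₃.card → k.val = j.val + E₃.card → l k = star (l j) := by
    intro j k h1 h2 hk
    rw [l₄ k (by omega), l₃ j h1 h2]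
    congr 4
    omega
  have hreal : ∀ x ∈ E, x.im = 0 → ∃ y : ℝ, g x = y ∧ 0 < y ∧ x.re = y ^ 2 := by
    intro x hx h
    rcases hg x hx with ⟨-, y, hy, e, e'⟩ | ⟨h', -⟩ | ⟨h', -⟩
    · refine ⟨y, e, hy, ?_⟩
      rw [e', ← Complex.ofReal_pow, Complex.ofReal_re]
    · linarith
    · linarith
  let D : BishopData p :=
    { e := E₁.card
      h := E₂.card
      s := E₃.card
      card_eq := hsum
      γ := fun j => g (l j)
      elliptic := by
        intro j hj
        have := Finset.mem_filter.1 (m₁ j hj)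
        obtain ⟨y, h1, h2, h3⟩ := hreal _ this.1 this.2.1
        refine ⟨y, h1, h2, ?_⟩
        have := this.2.2
        nlinarith
      hyperbolic := by
        intro j hj hj'
        have := Finset.mem_filter.1 (m₂ j hj hj')
        obtain ⟨y, h1, h2, h3⟩ := hreal _ this.1 this.2.1
        refine ⟨y, h1, ?_⟩
        have h4 : (1 / 4 : ℝ) ≤ y ^ 2 := h3 ▸ not_lt.1 this.2.2
        refine lt_of_le_of_ne (by nlinarith) fun e => hquarter ?_
        have h5 : l j = 1 / 4 := by
          refine Complex.ext ?_ ?_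
          · rw [h3, ← e]; norm_num
          · rw [this.2.1]; norm_num
        rw [← h5]
        exact this.1
      cplx := by
        intro j hj hj'
        have := Finset.mem_filter.1 (m₃ j hj hj')
        rcases hg _ this.1 with ⟨e, -⟩ | ⟨-, h1, h2, -⟩ | ⟨e, -⟩
        · exact absurd e this.2.ne
        · exact ⟨h1, h2⟩
        · exact absurd this.2 (not_lt.2 e.le)
      cplx' := by
        intro j k hj hj' hk
        have h1 := Finset.mem_filter.1 (m₃ j hj hj')
        have h2 := (hg _ h1.1).conj h1.2.ne
        rw [← hshift j k hj hj' hk] at h2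
        exact (hg _ (mE k)).unique h2 }
  refine ⟨D, l, hinj, fun j => ⟨mE j, ?_, rfl⟩⟩
  by_cases h1 : j.val < E₁.card + E₂.card
  · rw [D.partner_of_lt h1]
    refine (Complex.conj_eq_iff_im.2 ?_).symm
    by_cases h2 : j.val < E₁.card
    · exact (Finset.mem_filter.1 (m₁ j h2)).2.1
    · exact (Finset.mem_filter.1 (m₂ j (not_lt.1 h2) h1)).2.1
  by_cases h2 : j.val < E₁.card + E₂.card + E₃.card
  · exact hshift j _ (not_lt.1 h1) h2 (D.partner_of_mid (not_lt.1 h1) h2)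
  · have h3 : (D.partner j).val = j.val - E₃.card := D.partner_of_ge (not_lt.1 h2)
    rw [hshift (D.partner j) j (by omega) (by omega) (by omega), star_star]

/-- The normal form of a matrix `b` under the action `b ↦ A⁻¹ b Ā`, for `b b̄` with distinct
eigenvalues other than `0` and `1/4`. -/
theorem exists_bishopData_of_eigSet {b : Matrix (Fin p) (Fin p) ℂ}
    (hcard : (eigSet (b * b.map star)).ncard = p) (h0 : (0 : ℂ) ∉ eigSet (b * b.map star))
    (hquarter : (1 / 4 : ℂ) ∉ eigSet (b * b.map star)) :
    ∃ (D : BishopData p) (A : Matrix (Fin p) (Fin p) ℂ), IsUnit A ∧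
      b * A.map star = A * D.mat ∧ Function.Injective D.lam := by
  obtain ⟨v, g, hvg⟩ := exists_normalized_eigenvectors hcard h0
  have hfin := finite_eigSet (b * b.map star)
  have hmem : ∀ {l : ℂ}, l ∈ hfin.toFinset ↔ l ∈ eigSet (b * b.map star) := hfin.mem_toFinset
  obtain ⟨D, l, hl, hD⟩ := exists_bishopData_of_roots (p := p) (E := hfin.toFinset)
    (by rw [← Set.ncard_eq_toFinset_card _ hfin, hcard])
    (fun l h => hmem.2 (hvg l (hmem.1 h)).2.2.2.1) (fun h => hquarter (hmem.1 h))
    (g := g) fun l h => (hvg l (hmem.1 h)).2.2.1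
  have hv : ∀ j, v (l j) ≠ 0 := fun j => (hvg _ (hmem.1 (hD j).1)).1
  have hN : ∀ j, (b * b.map star).mulVec (v (l j)) = l j • v (l j) := fun j =>
    (hvg _ (hmem.1 (hD j).1)).2.1
  have hb : ∀ j, b.mulVec (star (v (l j))) = D.γ (D.partner j) • v (l (D.partner j)) := by
    intro j
    rw [(hD (D.partner j)).2.2, (hD j).2.1]
    exact (hvg _ (hmem.1 (hD j).1)).2.2.2.2
  have hli := linearIndependent_eigenvectors hl hv hN
  refine ⟨D, Matrix.of fun i j => v (l j) i, ?_, ?_, ?_⟩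
  · rw [← Matrix.linearIndependent_cols_iff_isUnit]
    exact hli
  · ext i j
    rw [D.mul_mat_apply, Matrix.of_apply, mul_comm]
    exact congrFun (hb j) i
  -- Applying `v ↦ b v̄` twice to an eigenvector shows that its eigenvalue is the diagonal entry of
  -- `γ γ̄`.
  · have : D.lam = l := by
      funext j
      have h1 := hN j
      rw [← Matrix.mulVec_mulVec] at h1
      have h2 := star_mulVec_map b (star (v (l j)))
      rw [star_star] at h2
      rw [← h2, hb, star_smul, Matrix.mulVec_smul, hb, D.partner_partner, smul_smul] at h1
      rw [BishopData.lam, mul_comm]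
      exact smul_left_injective ℂ (hv j) h1
    rw [this]
    exact hl

end CRQuadric

/-! ### Equivalences between quadrics. -/

namespace CRQuadric

variable {p : ℕ}

theorem diagPerm_mulVec (ν : Equiv.Perm (Fin p)) (d : Fin p → ℂ) (v : V p) (j : Fin p) :
    (diagPerm ν d).mulVec v j = d j * v (ν j) := by
  simp [diagPerm, Matrix.mulVec, dotProduct]

theorem diagPerm_mul_diagPerm_symm (ν : Equiv.Perm (Fin p)) {d : Fin p → ℂ} (hd : ∀ j, d j ≠ 0) :
    diagPerm ν d * diagPerm ν⁻¹ (fun k => (d (ν⁻¹ k))⁻¹) = 1 := by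
  refine Matrix.mulVec_injective (funext fun v => funext fun j => ?_)
  rw [← Matrix.mulVec_mulVec, diagPerm_mulVec, diagPerm_mulVec, Matrix.one_mulVec]
  simp [hd j]

theorem isUnit_diagPerm (ν : Equiv.Perm (Fin p)) {d : Fin p → ℂ} (hd : ∀ j, d j ≠ 0) :
    IsUnit (diagPerm ν d) :=
  IsUnit.of_mul_eq_one _ (diagPerm_mul_diagPerm_symm ν hd)

/-- Some term of the Leibniz expansion of an invertible determinant is nonzero. -/
theorem exists_perm_apply_ne_zero {M : Matrix (Fin p) (Fin p) ℂ} (hM : IsUnit M) :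
    ∃ π : Equiv.Perm (Fin p), ∀ i, M (π i) i ≠ 0 := by
  by_contra hn
  push Not at hn
  have h0 : M.det = 0 := by
    rw [Matrix.det_apply]
    refine Finset.sum_eq_zero fun π _ => ?_
    obtain ⟨i, hi⟩ := hn π
    have : ∏ i, M (π i) i = 0 := Finset.prod_eq_zero (Finset.mem_univ i) hi
    simp only [this, smul_zero]
  have := (Matrix.isUnit_iff_isUnit_det _).1 hM
  rw [h0] at this
  exact not_isUnit_zero this

/-- Separation of an identity of quadratic polynomials in `(v, v̄)` into types. -/
theorem separate_types {X Y X' Y' U : Matrix (Fin p) (Fin p) ℂ} {P : Fin p → QuadraticForm ℂ (V p)}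
    (h : ∀ (v : V p) j, (X'.mulVec v j - 2 * Y'.mulVec (star v) j) ^ 2 =
      ∑ k, U j k * (X.mulVec v k - 2 * Y.mulVec (star v) k) ^ 2 + P j v) :
    (∀ (w : V p) j, Y'.mulVec w j ^ 2 = ∑ k, U j k * Y.mulVec w k ^ 2) ∧
    ∀ (v w : V p) j, X'.mulVec v j * Y'.mulVec w j =
      ∑ k, U j k * (X.mulVec v k * Y.mulVec w k) := by
  let a : Fin p → V p → ℂ := fun j v => X'.mulVec v j ^ 2 - ∑ k, U j k * X.mulVec v k ^ 2 - P j v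
  let m : Fin p → V p → V p → ℂ := fun j v w => X'.mulVec v j * Y'.mulVec w j -
    ∑ k, U j k * (X.mulVec v k * Y.mulVec w k)
  let c : Fin p → V p → ℂ := fun j w => Y'.mulVec w j ^ 2 - ∑ k, U j k * Y.mulVec w k ^ 2
  have ha : ∀ j (r : ℂ) v, a j (r • v) = r ^ 2 * a j v := by
    intro j r v
    simp only [a, Matrix.mulVec_smul, Pi.smul_apply, smul_eq_mul, QuadraticMap.map_smul, mul_sub,
      Finset.mul_sum]
    refine congrArg₂ _ (congrArg₂ _ (by ring) (Finset.sum_congr rfl fun k _ => by ring)) (by ring)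
  have hc : ∀ j (r : ℂ) v, c j (r • v) = r ^ 2 * c j v := by
    intro j r v
    simp only [c, Matrix.mulVec_smul, Pi.smul_apply, smul_eq_mul, mul_sub, Finset.mul_sum]
    exact congrArg₂ _ (by ring) (Finset.sum_congr rfl fun k _ => by ring)
  have hm : ∀ j (r t : ℂ) v w, m j (r • v) (t • w) = r * t * m j v w := by
    intro j r t v w
    simp only [m, Matrix.mulVec_smul, Pi.smul_apply, smul_eq_mul, mul_sub, Finset.mul_sum]
    exact congrArg₂ _ (by ring) (Finset.sum_congr rfl fun k _ => by ring)
  have hadd : ∀ j v v' w w', m j (v + v') (w + w') = m j v w + m j v w' + m j v' w + m j v' w' := by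
    intro j v v' w w'
    have : ∀ k, U j k * (X.mulVec (v + v') k * Y.mulVec (w + w') k) =
        U j k * (X.mulVec v k * Y.mulVec w k) + U j k * (X.mulVec v k * Y.mulVec w' k) +
        U j k * (X.mulVec v' k * Y.mulVec w k) + U j k * (X.mulVec v' k * Y.mulVec w' k) := by
      intro k
      simp only [Matrix.mulVec_add, Pi.add_apply]
      ring
    simp only [m, this, Finset.sum_add_distrib]
    simp only [Matrix.mulVec_add, Pi.add_apply]
    ring
  have hsum : ∀ j v, a j v - 4 * m j v (star v) + 4 * c j (star v) = 0 := by
    intro j v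
    have h1 := h v j
    have h2 : ∑ k, U j k * (X.mulVec v k - 2 * Y.mulVec (star v) k) ^ 2 =
        ∑ k, U j k * X.mulVec v k ^ 2 - 4 * ∑ k, U j k * (X.mulVec v k * Y.mulVec (star v) k) +
        4 * ∑ k, U j k * Y.mulVec (star v) k ^ 2 := by
      simp only [Finset.mul_sum]
      rw [← Finset.sum_sub_distrib, ← Finset.sum_add_distrib]
      exact Finset.sum_congr rfl fun k _ => by ring
    rw [h2] at h1
    simp only [a, m, c]
    linear_combination h1
  have hI : star Complex.I = -Complex.I := Complex.conj_I
  have hI1 : star (1 + Complex.I) = 1 - Complex.I := by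
    rw [star_add, star_one, hI, sub_eq_add_neg]
  have hI2 := Complex.I_mul_I
  have hmc : ∀ j v, m j v (star v) = 0 ∧ c j (star v) = 0 := by
    intro j v
    have e1 := hsum j v
    -- Under `v ↦ r v` the three types scale by `r²`, `|r|²` and `r̄²`; the values `r = 1, i, 1 + i`
    -- separate them.
    have e2 := hsum j (Complex.I • v)
    have e3 := hsum j ((1 + Complex.I) • v)
    rw [star_smul, ha, hm, hc, hI] at e2
    rw [star_smul, ha, hm, hc, hI1] at e3
    have f1 : m j v (star v) = 0 := by
      linear_combination (-1 / 8 : ℂ) * (e1 + e2) + (1 / 8 : ℂ) *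
        (a j v + 4 * m j v (star v) + 4 * c j (star v)) * hI2
    have f2 : Complex.I * (a j v - 4 * c j (star v)) = 0 := by
      linear_combination (1 / 2 : ℂ) * e3 - (1 / 2 : ℂ) * (a j v + 4 * m j v (star v) +
        4 * c j (star v)) * hI2 + 4 * f1
    have f3 := (mul_eq_zero.1 f2).resolve_left Complex.I_ne_zero
    refine ⟨f1, ?_⟩
    linear_combination (1 / 8 : ℂ) * e1 - (1 / 8 : ℂ) * f3 + (1 / 2 : ℂ) * f1
  refine ⟨fun w j => ?_, fun v w j => ?_⟩
  · have := (hmc j (star w)).2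
    rw [star_star] at this
    exact sub_eq_zero.1 this
  -- Polarization with `v + w̄` and `v + i w̄` frees the second argument from being `v̄`.
  · have e1 := (hmc j (v + star w)).1
    have e2 := (hmc j (v + Complex.I • star w)).1
    rw [star_add, star_star, hadd, (hmc j v).1] at e1
    rw [star_add, star_smul, star_star, hadd, (hmc j v).1, hI] at e2
    have h1 := hm j 1 (-Complex.I) v w
    have h2 := hm j Complex.I 1 (star w) (star v)
    have h3 := hm j Complex.I (-Complex.I) (star w) w
    have h4 := (hmc j (star w)).1
    rw [star_star] at h4
    rw [one_smul] at h1 h2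
    rw [h1, h2, h3, h4] at e2
    rw [h4] at e1
    have h5 : Complex.I * (-m j v w + m j (star w) (star v)) = 0 := by linear_combination e2
    have h6 := (mul_eq_zero.1 h5).resolve_left Complex.I_ne_zero
    have h7 : m j v w = 0 := by linear_combination (1 / 2 : ℂ) * e1 - (1 / 2 : ℂ) * h6
    exact sub_eq_zero.1 h7

/-- In `h1` the cross terms of each squared row of `T` vanish, so a row has at most one nonzero
entry, and invertibility places these entries along a permutation. Dividing `h2` by the surviving
entry gives `X' = T X`. -/
theorem exists_diagPerm_of_squares {X X' T U : Matrix (Fin p) (Fin p) ℂ} (hT : IsUnit T)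
    (h1 : ∀ (x : V p) j, T.mulVec x j ^ 2 = ∑ k, U j k * x k ^ 2)
    (h2 : ∀ (v x : V p) j, X'.mulVec v j * T.mulVec x j = ∑ k, U j k * (X.mulVec v k * x k)) :
    ∃ (ν : Equiv.Perm (Fin p)) (d : Fin p → ℂ), (∀ j, d j ≠ 0) ∧ T = diagPerm ν d ∧
      X' = T * X := by
  have hTs : ∀ j k, T.mulVec (Pi.single k 1) j = T j k := fun j k => by simp
  have hU : ∀ j k, U j k = T j k ^ 2 := by
    intro j k
    have := h1 (Pi.single k 1) j
    rw [hTs, Finset.sum_eq_single k] at this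
    · simpa using this.symm
    · intro l _ hl; simp [hl]
    · simp
  have hoff : ∀ j k l, k ≠ l → T j k * T j l = 0 := by
    intro j k l hkl
    have := h1 (Pi.single k 1 + Pi.single l 1) j
    rw [Matrix.mulVec_add, Pi.add_apply, hTs, hTs, Fintype.sum_eq_add k l hkl] at this
    · simp only [Pi.add_apply, Pi.single_eq_same, Pi.single_eq_of_ne hkl,
        Pi.single_eq_of_ne hkl.symm, hU] at this
      linear_combination (1 / 2 : ℂ) * this
    · rintro x ⟨hx1, hx2⟩
      simp [hx1, hx2]
  obtain ⟨π, hπ⟩ := exists_perm_apply_ne_zero hT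
  have hne : ∀ j, T j (π⁻¹ j) ≠ 0 := by
    intro j
    simpa using hπ (π⁻¹ j)
  have hzero : ∀ j k, k ≠ π⁻¹ j → T j k = 0 := fun j k hk =>
    (mul_eq_zero.1 (hoff j k _ hk)).resolve_right (hne j)
  have hTd : T = diagPerm π⁻¹ fun j => T j (π⁻¹ j) := by
    ext j k
    by_cases hk : k = π⁻¹ j
    · simp [diagPerm, hk]
    · simp only [diagPerm, Matrix.of_apply, if_neg hk, hzero j k hk]
  refine ⟨π⁻¹, fun j => T j (π⁻¹ j), hne, hTd, ?_⟩
  refine Matrix.mulVec_injective (funext fun v => funext fun j => ?_)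
  have h3 := h2 v (Pi.single (π⁻¹ j) 1) j
  rw [hTs, Finset.sum_eq_single (π⁻¹ j)] at h3
  · rw [hU, Pi.single_eq_same, mul_one] at h3
    have h4 : X'.mulVec v j = T j (π⁻¹ j) * X.mulVec v (π⁻¹ j) := by
      refine mul_right_cancel₀ (hne j) (h3.trans (by ring))
    rw [h4, ← Matrix.mulVec_mulVec]
    conv_rhs => rw [hTd, diagPerm_mulVec]
  · intro l _ hl
    rw [Pi.single_eq_of_ne hl, mul_zero, mul_zero]
  · simp

namespace BishopData

/-- The right-hand side of the equation of the quadric. -/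
def quadricMap (D : BishopData p) (B : Matrix (Fin p) (Fin p) ℂ) (v : V p) : V p :=
  fun j => (B.mulVec (v - (2 : ℂ) • D.mat.mulVec (star v)) j) ^ 2

theorem quadric_eq (D : BishopData p) (B : Matrix (Fin p) (Fin p) ℂ) :
    D.quadric B = {z : V p × V p | z.2 = D.quadricMap B z.1} := by
  ext z
  exact funext_iff.symm

theorem quadricMap_smul (D : BishopData p) (B : Matrix (Fin p) (Fin p) ℂ) (t : ℝ) (v : V p) :
    D.quadricMap B ((t : ℂ) • v) = (t : ℂ) ^ 2 • D.quadricMap B v := by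
  have ht : star (t : ℂ) = t := Complex.conj_ofReal t
  ext j
  simp only [quadricMap, star_smul, ht, Matrix.mulVec_smul, smul_comm (2 : ℂ) (t : ℂ), ← smul_sub,
    Pi.smul_apply, smul_eq_mul, mul_pow]

theorem continuous_quadricMap (D : BishopData p) (B : Matrix (Fin p) (Fin p) ℂ) :
    Continuous (D.quadricMap B) := by
  unfold quadricMap
  have hm : ∀ M : Matrix (Fin p) (Fin p) ℂ, Continuous fun v : V p => M.mulVec v := fun M =>
    continuous_const.matrix_mulVec continuous_id
  have h1 : Continuous fun v : V p => v - (2 : ℂ) • D.mat.mulVec (star v) :=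
    by
    have := (hm D.mat).comp (continuous_star (R := V p))
    exact continuous_id.sub (this.const_smul (2 : ℂ))
  exact continuous_pi fun j => ((continuous_apply j).comp ((hm B).comp h1)).pow 2

/-- The linear data of an equivalence of two quadrics. -/
theorem exists_diagPerm_of_holEquiv {D D' : BishopData p} {B B' : Matrix (Fin p) (Fin p) ℂ}
    (hB : IsUnit B) (hB' : IsUnit B') (h : HolEquiv (D.quadric B) (D'.quadric B')) :
    ∃ (A : Matrix (Fin p) (Fin p) ℂ) (ν : Equiv.Perm (Fin p)) (d : Fin p → ℂ),
      IsUnit A ∧ (∀ j, d j ≠ 0) ∧ B' * A = diagPerm ν d * B ∧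
      D'.mat * A.map star = A * D.mat := by
  rw [quadric_eq, quadric_eq] at h
  obtain ⟨A, U, P, hA, hU, hAU⟩ := exists_quadratic_of_holEquiv_graph (D.quadricMap_smul B)
    (D'.quadricMap_smul B') (D'.continuous_quadricMap B') h
  have hY : IsUnit (B * D.mat) := hB.mul D.isUnit_mat
  have hY' : IsUnit (B' * (D'.mat * A.map star)) :=
    hB'.mul (D'.isUnit_mat.mul (isUnit_map_star hA))
  obtain ⟨s1, s2⟩ := separate_types (X := B) (Y := B * D.mat) (X' := B' * A)
    (Y' := B' * (D'.mat * A.map star)) (U := U) (P := P) (fun v j => by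
      have h1 := congrFun (hAU v) j
      have h2 : ∀ k, D.quadricMap B v k =
          (B.mulVec v k - 2 * (B * D.mat).mulVec (star v) k) ^ 2 := by
        intro k
        simp only [quadricMap, Matrix.mulVec_sub, Matrix.mulVec_smul, Matrix.mulVec_mulVec,
          Pi.sub_apply, Pi.smul_apply, smul_eq_mul]
      have h3 : D'.quadricMap B' (A.mulVec v) j = ((B' * A).mulVec v j -
          2 * (B' * (D'.mat * A.map star)).mulVec (star v) j) ^ 2 := by
        simp only [quadricMap, star_mulVec_map, Matrix.mulVec_sub, Matrix.mulVec_smul,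
          Matrix.mulVec_mulVec, Pi.sub_apply, Pi.smul_apply, smul_eq_mul]
      rw [h3, Pi.add_apply] at h1
      rw [h1]
      simp only [← h2]
      rfl)
  -- Substituting `w = (B γ)⁻¹ x` turns the right-hand squares into those of the coordinates of `x`.
  obtain ⟨Z, hZ⟩ := hY.exists_right_inv
  have hZ' : Z * (B * D.mat) = 1 := mul_eq_one_comm.1 hZ
  have hw : ∀ x : V p, (B * D.mat).mulVec (Z.mulVec x) = x := fun x => by
    rw [Matrix.mulVec_mulVec, hZ, Matrix.one_mulVec]
  set T := B' * (D'.mat * A.map star) * Z with hTdef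
  have hT : IsUnit T := hY'.mul (IsUnit.of_mul_eq_one _ hZ')
  obtain ⟨ν, d, hd, hTd, hX⟩ := exists_diagPerm_of_squares (X := B) (X' := B' * A) (U := U) hT
    (fun x j => by
      have := s1 (Z.mulVec x) j
      rwa [hw, Matrix.mulVec_mulVec] at this)
    (fun v x j => by
      have := s2 v (Z.mulVec x) j
      rwa [hw, Matrix.mulVec_mulVec] at this)
  refine ⟨A, ν, d, hA, hd, by rw [hX, hTd], ?_⟩
  have h1 : B' * (D'.mat * A.map star) = B' * (A * D.mat) := by
    calc B' * (D'.mat * A.map star) = T * (B * D.mat) := by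
          rw [hTdef, mul_assoc _ Z, hZ', mul_one]
      _ = B' * (A * D.mat) := by rw [← mul_assoc, ← hX, mul_assoc]
  exact hB'.mul_left_cancel h1

/-- Combining `γ' Ā = A γ` with its conjugate gives `γ' γ̄' A = A γ γ̄`, and both products are
diagonal. -/
theorem lam_mul_eq {D D' : BishopData p} {A : Matrix (Fin p) (Fin p) ℂ}
    (h : D'.mat * A.map star = A * D.mat) (i j : Fin p) : D'.lam i * A i j = A i j * D.lam j := by
  have h1 : ∀ i j, D'.γ i * star (A (D'.partner i) j) =
      A i (D.partner j) * D.γ (D.partner j) := by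
    intro i j
    have := congrFun (congrFun h i) j
    rwa [mat_mul_apply, mul_mat_apply] at this
  have e1 := h1 i (D.partner j)
  have e2 := congrArg star (h1 (D'.partner i) j)
  rw [D.partner_partner] at e1
  simp only [D'.partner_partner, star_mul', star_star] at e2
  rw [lam, lam]
  linear_combination D'.γ i * e2 + star (D.γ (D.partner j)) * e1

theorem exists_perm_lam {D D' : BishopData p} {A : Matrix (Fin p) (Fin p) ℂ} (hA : IsUnit A)
    (h : D'.mat * A.map star = A * D.mat) :
    ∃ π : Equiv.Perm (Fin p), ∀ j, D'.lam j = D.lam (π j) := by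
  obtain ⟨π, hπ⟩ := exists_perm_apply_ne_zero hA
  refine ⟨π⁻¹, fun j => ?_⟩
  have h1 := lam_mul_eq h j (π⁻¹ j)
  rw [mul_comm] at h1
  refine mul_left_cancel₀ ?_ h1
  simpa using hπ (π⁻¹ j)

theorem val_lt_iff (D : BishopData p) (j : Fin p) :
    (j.val < D.e + D.h ↔ (D.γ j).im = 0) ∧
      (j.val < D.e ↔ (D.γ j).im = 0 ∧ (D.γ j).re < 1 / 2) := by
  by_cases h1 : j.val < D.e
  · obtain ⟨x, hx, h2, h3⟩ := D.elliptic j h1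
    have h4 : j.val < D.e + D.h := by omega
    simp [h1, h4, hx]
    linarith
  by_cases h2 : j.val < D.e + D.h
  · obtain ⟨x, hx, h3⟩ := D.hyperbolic j (not_lt.1 h1) h2
    simp [h1, h2, hx]
    linarith
  have h0 : (D.γ j).im ≠ 0 := by
    by_cases h3 : j.val < D.e + D.h + D.s
    · exact (D.cplx j (not_lt.1 h2) h3).2.ne'
    · have hc := D.card_eq
      have hj := j.isLt
      have h4 := D.partner_of_ge (not_lt.1 h3)
      have h5 : D.e + D.h ≤ (D.partner j).val := by omega
      have h6 : (D.partner j).val < D.e + D.h + D.s := by omega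
      have h7 : D.γ j = 1 - star (D.γ (D.partner j)) := D.cplx' _ j h5 h6 (by omega)
      rw [h7]
      have := (D.cplx _ h5 h6).2
      simp only [Complex.star_def, Complex.sub_im, Complex.one_im, Complex.conj_im]
      linarith
  exact ⟨⟨fun h => absurd h h2, fun h => absurd h h0⟩,
    fun h => absurd h h1, fun h => absurd h.1 h0⟩

theorem counts_eq {D D' : BishopData p} {π : Equiv.Perm (Fin p)}
    (h : ∀ j, D'.lam j = D.lam (π j)) :
    D'.e = D.e ∧ D'.h = D.h ∧ D'.s = D.s ∧ ∀ j, D'.γ j = D.γ (π j) := by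
  have hγ : ∀ j, D'.γ j = D.γ (π j) := fun j => by
    have h1 := D'.isBishopRoot j
    rw [h j] at h1
    exact h1.unique (D.isBishopRoot (π j))
  have c := D.card_eq
  have c' := D'.card_eq
  have hcard : ∀ n n' : ℕ, n ≤ p → n' ≤ p → (∀ j : Fin p, j.val < n' ↔ (π j).val < n) →
      n' = n := by
    intro n n' hn hn' hiff
    have h1 : (Finset.univ.filter fun j : Fin p => j.val < n').card =
        (Finset.univ.filter fun j : Fin p => j.val < n).card :=
      Finset.card_bij (fun j _ => π j) (fun j hj => by simpa [hiff] using hj)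
        (fun a _ b _ hab => π.injective hab)
        (fun j hj => ⟨π⁻¹ j, by simpa [hiff] using hj, by simp⟩)
    rw [Fin.card_filter_val_lt, Fin.card_filter_val_lt] at h1
    omega
  have he := hcard D.e D'.e (by omega) (by omega) fun j => by
    rw [(D'.val_lt_iff j).2, (D.val_lt_iff (π j)).2, hγ]
  have hh := hcard (D.e + D.h) (D'.e + D'.h) (by omega) (by omega) fun j => by
    rw [(D'.val_lt_iff j).1, (D.val_lt_iff (π j)).1, hγ]
  exact ⟨he, by omega, by omega, hγ⟩

theorem rel_of_holEquiv {D : BishopData p} (hinj : Function.Injective D.lam)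
    {B B' : Matrix (Fin p) (Fin p) ℂ} (hB : IsUnit B) (hB' : IsUnit B')
    (h : HolEquiv (D.quadric B) (D.quadric B')) : D.Rel B B' := by
  obtain ⟨A, ν, d, hA, hd, h1, h2⟩ := exists_diagPerm_of_holEquiv hB hB' h
  have hoff : ∀ i j, i ≠ j → A i j = 0 := by
    intro i j hij
    have h3 := lam_mul_eq h2 i j
    have h4 : (D.lam i - D.lam j) * A i j = 0 := by linear_combination h3
    exact (mul_eq_zero.1 h4).resolve_left (sub_ne_zero.2 fun e => hij (hinj e))
  have hAd : A = Matrix.diagonal fun j => A j j := by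
    ext i j
    by_cases hij : i = j
    · subst hij; simp
    · rw [hoff i j hij, Matrix.diagonal_apply_ne _ hij]
  have hne : ∀ j, A j j ≠ 0 := by
    intro j h0
    obtain ⟨π, hπ⟩ := exists_perm_apply_ne_zero hA
    by_cases hj : π j = j
    · exact hπ j (by rw [hj, h0])
    · exact hπ j (hoff _ _ hj)
  have hstar : ∀ j, A (D.partner j) (D.partner j) = star (A j j) := by
    intro j
    have := congrFun (congrFun h2 j) (D.partner j)
    rw [mat_mul_apply, mul_mat_apply, D.partner_partner, mul_comm] at this
    have := mul_right_cancel₀ (D.γ_ne_zero j) this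
    rw [← this, Matrix.map_apply, star_star]
  have hd' : ∀ k, (d (ν⁻¹ k))⁻¹ ≠ 0 := fun k => inv_ne_zero (hd _)
  -- The relation at hand is `B' = diag_ν(d) B A⁻¹`, whereas `Rel` carries the inverse on the left
  -- factor; hence the inverse data.
  refine ⟨ν⁻¹, fun k => (d (ν⁻¹ k))⁻¹, fun j => (A j j)⁻¹, hd', fun j => inv_ne_zero (hne j),
    fun j => by simp only [hstar, star_inv₀], ?_⟩
  have h3 : (diagPerm ν⁻¹ fun k => (d (ν⁻¹ k))⁻¹)⁻¹ = diagPerm ν d :=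
    Matrix.inv_eq_left_inv (diagPerm_mul_diagPerm_symm ν hd)
  have h4 : A * Matrix.diagonal (fun j => (A j j)⁻¹) = 1 := by
    conv_lhs => rw [hAd]
    rw [Matrix.diagonal_mul_diagonal, ← Matrix.diagonal_one]
    congr 1
    funext j
    simp [hne j]
  rw [h3, ← h1, mul_assoc, h4, mul_one]

/-- The condition on `a` says exactly that `diag a` commutes with `v ↦ v - 2 γ v̄`; the factor
`diag_ν d` becomes a permutation with entries `d²` after squaring, absorbed in `z''`. -/
theorem Rel.quadraticEquiv {D : BishopData p} {B B' : Matrix (Fin p) (Fin p) ℂ}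
    (h : D.Rel B B') : QuadraticEquiv (D.quadric B') (D.quadric B) := by
  obtain ⟨ν, d, a, hd, ha, hstar, rfl⟩ := h
  have hdu := (Matrix.isUnit_iff_isUnit_det _).1 (isUnit_diagPerm ν hd)
  have hau : IsUnit (Matrix.diagonal a) := by
    rw [Matrix.isUnit_iff_isUnit_det, Matrix.det_diagonal]
    exact isUnit_iff_ne_zero.2 (Finset.prod_ne_zero_iff.2 fun j _ => ha j)
  rw [quadric_eq, quadric_eq]
  refine quadraticEquiv_graph (A := Matrix.diagonal a) (U := diagPerm ν fun j => d j ^ 2)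
    (P := 0) hau (isUnit_diagPerm ν fun j => pow_ne_zero 2 (hd j)) fun v => ?_
  set B' := (diagPerm ν d)⁻¹ * B * Matrix.diagonal a with hB'
  have h1 : diagPerm ν d * B' = B * Matrix.diagonal a := by
    rw [hB', mul_assoc, ← mul_assoc, Matrix.mul_nonsing_inv _ hdu, one_mul]
  have h2 : (Matrix.diagonal a).mulVec v - (2 : ℂ) • D.mat.mulVec (star ((Matrix.diagonal a).mulVec v))
      = (Matrix.diagonal a).mulVec (v - (2 : ℂ) • D.mat.mulVec (star v)) := by
    funext j
    simp only [Pi.sub_apply, Pi.smul_apply, Matrix.mulVec_diagonal, mat_mulVec, smul_eq_mul,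
      Pi.star_apply, star_mul', hstar, star_star]
    ring
  funext j
  rw [Pi.add_apply, diagPerm_mulVec]
  simp only [quadricMap, h2]
  rw [Matrix.mulVec_mulVec, ← h1, ← Matrix.mulVec_mulVec, diagPerm_mulVec]
  simp [mul_pow]

end BishopData

/-! ### Existence of the normal form and the theorem. -/

section Main

variable {h : Fin p → LinearMap.BilinForm ℂ (V p)} {q : Fin p → QuadraticForm ℂ (V p)}

theorem exists_quadraticEquiv_quadric (hE : CondE h q) :
    ∃ (D : BishopData p) (B : Matrix (Fin p) (Fin p) ℂ), IsUnit B ∧ Function.Injective D.lam ∧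
      QuadraticEquiv (quadM h q) (D.quadric B) := by
  obtain ⟨a, C, S, P, hC, hS, hCS, hspec⟩ := exists_normalization hE
  obtain ⟨hcard, h0, h4⟩ := eigSet_of_sigma hspec
  have hau : IsUnit a := by
    have hu := isUnit_of_zero_notMem_eigSet h0
    rw [Matrix.isUnit_iff_isUnit_det, Matrix.det_mul] at hu
    exact (Matrix.isUnit_iff_isUnit_det _).2 (isUnit_of_mul_isUnit_right hu)
  obtain ⟨b, hab⟩ := hau.exists_right_inv
  have hE' := eigSet_inv_eq hab h0
  obtain ⟨D, A, hA, hbA, hinj⟩ := exists_bishopData_of_eigSet (b := b)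
    (by rw [hE', Set.ncard_image_of_injective _ inv_injective, hcard])
    (by
      rw [hE']
      rintro ⟨κ, hκ, e⟩
      rw [inv_eq_zero] at e
      exact h0 (e ▸ hκ))
    (by
      rw [hE']
      rintro ⟨κ, hκ, e⟩
      have e : κ⁻¹ = 1 / 4 := e
      have : κ = 4 := by rw [← inv_inv κ, e]; norm_num
      exact h4 (this ▸ hκ))
  obtain ⟨A', hA'⟩ := hA.exists_right_inv
  have hA'2 : A' * A = 1 := mul_eq_one_comm.1 hA'
  obtain ⟨C', hC'⟩ := hC.exists_right_inv
  have hC'2 : C' * C = 1 := mul_eq_one_comm.1 hC'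
  -- `S (z̄ - a z / 2) = -½ S a (z - 2 b z̄)`, and `z = A ζ` with `b Ā = A γ` turns this into `-½ S
  -- a A (ζ - 2 γ ζ̄)`.
  refine ⟨D, (-(1 / 2) : ℂ) • (S * a * A), ?_, hinj, ?_⟩
  · have hk : IsUnit (-(1 / 2) : ℂ) := isUnit_iff_ne_zero.2 (by norm_num)
    have := ((hS.mul hau).mul hA).smul (hk.unit)
    exact this
  rw [D.quadric_eq]
  refine quadraticEquiv_graph (G := fun v => quadE h q v (star v)) (A := A') (U := C')
    (P := fun j => ∑ k, C' j k • P k) (IsUnit.of_mul_eq_one _ hA'2) (IsUnit.of_mul_eq_one _ hC'2)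
    fun v => ?_
  have h1 : (fun j => (∑ k, C' j k • P k) v) = C'.mulVec fun k => P k v := by
    funext j
    simp [Matrix.mulVec, dotProduct]
  rw [h1, ← Matrix.mulVec_add, hCS, Matrix.mulVec_mulVec, hC'2, Matrix.one_mulVec]
  funext k
  have h2 : A * D.mat * A'.map star = b := by
    rw [← hbA, mul_assoc, ← map_star_mul, hA', map_star_one, mul_one]
  have h3 : S * a * A * (D.mat * A'.map star) = S := by
    calc S * a * A * (D.mat * A'.map star) = S * a * (A * D.mat * A'.map star) := by
          simp only [mul_assoc]
      _ = S := by rw [h2, mul_assoc, hab, mul_one]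
  have h4 : S * a * A * A' = S * a := by rw [mul_assoc, hA', mul_one]
  simp only [BishopData.quadricMap, star_mulVec_map, Matrix.mulVec_sub, Matrix.mulVec_smul,
    Matrix.mulVec_mulVec, Matrix.smul_mul, h3, h4]
  congr 1
  simp only [Pi.sub_apply, Pi.smul_apply, Matrix.smul_mulVec, smul_eq_mul]
  ring

end Main

end CRQuadric

end

theorem theorem1p1 (p : ℕ) (h : Fin p → LinearMap.BilinForm ℂ (CRQuadric.V p))
    (q : Fin p → QuadraticForm ℂ (CRQuadric.V p)) (hE : CRQuadric.CondE h q) :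
    ∃ (D : CRQuadric.BishopData p) (B : Matrix (Fin p) (Fin p) ℂ), IsUnit B ∧
      -- `M` is equivalent to `Q_{B,γ}`
      CRQuadric.HolEquiv (CRQuadric.quadM h q) (D.quadric B) ∧
      CRQuadric.QuadraticEquiv (CRQuadric.quadM h q) (D.quadric B) ∧
      -- the numbers of components are unique, and so is `γ` up to the order of its entries
      (∀ (D' : CRQuadric.BishopData p) (B' : Matrix (Fin p) (Fin p) ℂ), IsUnit B' →
        CRQuadric.HolEquiv (CRQuadric.quadM h q) (D'.quadric B') →
          D'.e = D.e ∧ D'.h = D.h ∧ D'.s = D.s ∧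
          ∃ π : Equiv.Perm (Fin p), ∀ j, D'.γ j = D.γ (π j)) ∧
      -- for given `γ`, the matrix is unique exactly up to the equivalence relation
      (∀ (D' : CRQuadric.BishopData p) (B₁ B₂ : Matrix (Fin p) (Fin p) ℂ),
        IsUnit B₁ → IsUnit B₂ →
        CRQuadric.HolEquiv (CRQuadric.quadM h q) (D'.quadric B₁) →
          (CRQuadric.HolEquiv (CRQuadric.quadM h q) (D'.quadric B₂) ↔ D'.Rel B₁ B₂)) := by
  obtain ⟨D, B, hB, hinj, hequiv⟩ := CRQuadric.exists_quadraticEquiv_quadric hE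
  have hperm : ∀ (D' : CRQuadric.BishopData p) (B' : Matrix (Fin p) (Fin p) ℂ), IsUnit B' →
      CRQuadric.HolEquiv (CRQuadric.quadM h q) (D'.quadric B') →
      ∃ π : Equiv.Perm (Fin p), ∀ j, D'.lam j = D.lam (π j) := by
    intro D' B' hB' h'
    obtain ⟨A, -, -, hA, -, -, hAD⟩ := CRQuadric.BishopData.exists_diagPerm_of_holEquiv hB hB'
      (hequiv.holEquiv.symm.trans h')
    exact CRQuadric.BishopData.exists_perm_lam hA hAD
  refine ⟨D, B, hB, hequiv.holEquiv, hequiv, fun D' B' hB' h' => ?_,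
    fun D' B₁ B₂ hB₁ hB₂ h₁ => ⟨fun h₂ => ?_, fun hrel => ?_⟩⟩
  · obtain ⟨π, hπ⟩ := hperm D' B' hB' h'
    obtain ⟨e1, e2, e3, e4⟩ := CRQuadric.BishopData.counts_eq hπ
    exact ⟨e1, e2, e3, π, e4⟩
  · obtain ⟨π, hπ⟩ := hperm D' B₁ hB₁ h₁
    -- `D'` inherits distinct diagonal entries of `γ γ̄` from `D` through the permutation `π`.
    refine CRQuadric.BishopData.rel_of_holEquiv (fun i j hij => ?_) hB₁ hB₂ (h₁.symm.trans h₂)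
    rw [hπ, hπ] at hij
    exact π.injective (hinj hij)
  · exact h₁.trans hrel.quadraticEquiv.holEquiv.symm
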